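/- Theorem. Let $(M,g)$ be a connected smooth Riemannian manifold (positive definite metric) of dimension $n\ge 3$, with Levi-Civita connection $\nabla$, Ricci tensor $\mathsf{Ri}$ (the trace $\mathsf{Ri}(v,w)=\operatorname{tr}(u\mapsto R(u,v)w)$), scalar curvature $\mathsf{sc}=\operatorname{tr}_g\mathsf{Ri}$ and pointwise tensor norm $|\cdot|$. Suppose that $\mathsf{Ri}$ is not identically zero and that it is Ricci recurrent: there is a smooth one-form $\beta$, not identically zero, such that $\nabla\mathsf{Ri}=\beta\otimes\mathsf{Ri}$, i.e. $\mathsf{Ri}_{ij;\ell}=\beta_\ell\,\mathsf{Ri}_{ij}$. Then at every point of $M$ the scalar curvature is nonzero, and the Ricci tensor, viewed as an endomorphism of the tangent space by means of $g$, has the eigenvalue $\tfrac{\mathsf{sc}}{2}$ with multiplicity exactly $2$ and the eigenvalue $0$ with multiplicity exactly $n-2$. Moreover, at every point, \[ \beta=\nabla\ln|\mathsf{sc}|,\qquad \mathsf{sc}^2=2\,|\mathsf{Ri}|^2,\qquad \mathsf{Ri}\,\beta=\tfrac{\mathsf{sc}}{2}\,\beta , \] where in the last identity $\mathsf{Ri}$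 acts on $\beta$ after identifying one-forms and vectors by means of $g$. -/

import Mathlib

open Bundle Module
open scoped Manifold ContDiff

noncomputable section

/-! Levi-Civita connection, curvature and Ricci tensor of a Riemannian manifold.

Throughout, `M` is a manifold modelled on `EuclideanSpace ℝ (Fin n)` and the Riemannian metric is
the inner product `inner ℝ` on its tangent spaces. A vector field is a section
`X : (x : M) → TangentSpace (𝓡 n) x`. The letter `d` of a real function is `mvfderiv`. A tangent
vector `v` at `x` is extended to a vector field, smooth near `x`, by `FiberBundle.extend`. -/

section RicciGeometry

variable (n : ℕ) {M : Type*} [TopologicalSpace M] [ChartedSpace (EuclideanSpace ℝ (Fin n)) M]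
  [IsManifold (𝓡 n) ∞ M] [RiemannianBundle (fun x : M ↦ TangentSpace (𝓡 n) x)]

variable {n} in
/-- The extension of a tangent vector at `x` to a vector field which is smooth near `x`
(constant coefficients in the preferred chart at `x`). -/
def extendVector {x : M} (v : TangentSpace (𝓡 n) x) : (y : M) → TangentSpace (𝓡 n) y :=
  FiberBundle.extend (EuclideanSpace ℝ (Fin n)) v

instance (x : M) : FiniteDimensional ℝ (TangentSpace (𝓡 n) x) :=
  inferInstanceAs (FiniteDimensional ℝ (EuclideanSpace ℝ (Fin n)))

/-- An orthonormal basis of the tangent space at `x`. -/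
def tangentFrame (x : M) :
    OrthonormalBasis (Fin (finrank ℝ (TangentSpace (𝓡 n) x))) ℝ (TangentSpace (𝓡 n) x) :=
  stdOrthonormalBasis ℝ (TangentSpace (𝓡 n) x)

variable {n} in
/-- The right-hand side of the Koszul formula for `2 ⟨∇_X Y, Z⟩` at the point `x`. -/
def koszul (X Y Z : (x : M) → TangentSpace (𝓡 n) x) (x : M) : ℝ :=
  mvfderiv (𝓡 n) (fun y ↦ inner ℝ (Y y) (Z y)) x (X x)
    + mvfderiv (𝓡 n) (fun y ↦ inner ℝ (X y) (Z y)) x (Y x)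
    - mvfderiv (𝓡 n) (fun y ↦ inner ℝ (X y) (Y y)) x (Z x)
    + inner ℝ (VectorField.mlieBracket (𝓡 n) X Y x) (Z x)
    - inner ℝ (VectorField.mlieBracket (𝓡 n) X Z x) (Y x)
    - inner ℝ (VectorField.mlieBracket (𝓡 n) Y Z x) (X x)

variable {n} in
/-- The Levi-Civita covariant derivative `∇_X Y`: at the point `x` it is the tangent vector whose
inner product with `Z` is half the Koszul expression. -/
def leviCivita (X Y : (x : M) → TangentSpace (𝓡 n) x) (x : M) : TangentSpace (𝓡 n) x :=
  ∑ i, (koszul X Y (extendVector (tangentFrame n x i)) x / 2) • tangentFrame n x i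

variable {n} in
/-- The curvature `R(X, Y) Z = ∇_X ∇_Y Z - ∇_Y ∇_X Z - ∇_[X, Y] Z`. -/
def curvature (X Y Z : (x : M) → TangentSpace (𝓡 n) x) (x : M) : TangentSpace (𝓡 n) x :=
  leviCivita X (leviCivita Y Z) x - leviCivita Y (leviCivita X Z) x
    - leviCivita (VectorField.mlieBracket (𝓡 n) X Y) Z x

/-- The Ricci tensor: `Ri(v, w)` is the trace of `u ↦ R(u, v) w`. -/
def ricci (x : M) (v w : TangentSpace (𝓡 n) x) : ℝ :=
  ∑ i, inner ℝ
    (curvature (extendVector (tangentFrame n x i)) (extendVector v) (extendVector w) x)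
    (tangentFrame n x i)

/-- The Ricci tensor as an endomorphism of the tangent space (first index raised with the metric):
the linear map with `⟨Ri e_j, e_i⟩ = Ri(e_j, e_i)` in an orthonormal basis. -/
def ricciOperator (x : M) : TangentSpace (𝓡 n) x →ₗ[ℝ] TangentSpace (𝓡 n) x :=
  (tangentFrame n x).toBasis.constr ℝ
    fun j ↦ ∑ i, ricci n x (tangentFrame n x j) (tangentFrame n x i) • tangentFrame n x i

/-- The scalar curvature, the trace of the Ricci tensor. -/
def scalarCurvature (x : M) : ℝ :=
  ∑ i, ricci n x (tangentFrame n x i) (tangentFrame n x i)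

/-- The square `|Ri|²` of the pointwise norm of the Ricci tensor. -/
def ricciNormSq (x : M) : ℝ :=
  ∑ i, ∑ j, ricci n x (tangentFrame n x i) (tangentFrame n x j) ^ 2

variable {n} in
/-- The covariant derivative `(∇_u Ri)(v, w)` of the Ricci tensor at the point `x`, that is
`u (Ri(V, W)) - Ri(∇_u V, W) - Ri(V, ∇_u W)` for fields `V`, `W` extending `v`, `w`. -/
def covDerivRicci (x : M) (u v w : TangentSpace (𝓡 n) x) : ℝ :=
  mvfderiv (𝓡 n) (fun y ↦ ricci n y (extendVector v y) (extendVector w y)) x u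
    - ricci n x (leviCivita (extendVector u) (extendVector v) x) w
    - ricci n x v (leviCivita (extendVector u) (extendVector w) x)

variable {n} in
/-- The tangent vector `α^♯` dual to a covector `α` with respect to the metric. -/
def sharp {x : M} (α : TangentSpace (𝓡 n) x →L[ℝ] ℝ) : TangentSpace (𝓡 n) x :=
  ∑ i, α (tangentFrame n x i) • tangentFrame n x i

variable {n} in
/-- `β` is a smooth one-form, not identically zero, with `∇ Ri = β ⊗ Ri`, and `Ri` itself is not
identically zero. -/
structure IsRicciRecurrent (β : (x : M) → TangentSpace (𝓡 n) x →L[ℝ] ℝ) : Prop where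
  contMDiff : ContMDiff (𝓡 n) ((𝓡 n).prod 𝓘(ℝ, EuclideanSpace ℝ (Fin n) →L[ℝ] ℝ)) ∞
    (fun x ↦ TotalSpace.mk' (EuclideanSpace ℝ (Fin n) →L[ℝ] ℝ)
      (E := fun x : M ↦ TangentSpace (𝓡 n) x →L[ℝ] ℝ) x (β x))
  form_ne_zero : ∃ x, β x ≠ 0
  ricci_ne_zero : ∃ (x : M) (v w : TangentSpace (𝓡 n) x), ricci n x v w ≠ 0
  recurrent : ∀ (x : M) (u v w : TangentSpace (𝓡 n) x),
    covDerivRicci x u v w = β x u * ricci n x v w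

end RicciGeometry

end

/-! Let A be the Ricci endomorphism; it is symmetric and satisfies ∇A = β ⊗ A. Commuting two
covariant derivatives gives [R(a,b), A] = dβ(a,b) A (`curv_ricOp`). Composing with A and taking the
trace gives dβ · tr A² = 0, and tr A² = |A|², so R commutes with A wherever A ≠ 0
(`curv_ricOp_of_ne_zero`). By pair symmetry this reads R(Aa,b) = R(a,Ab), and differentiation
carries it over to ∇R (`covCurv_ricOp`).

The twice contracted second Bianchi identity says Ab = s b, where b is dual to β and s = tr A / 2
(`ricOp_sharp`). Hence (∇R)((A − s)v, b) = 0 and β((A − s)v) = 0, so the once contracted Bianchi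
identity (`sum_covCurv_add`) for b and (A − s)v reduces to |b|² Ric((A − s)v, w) = 0. Thus A² = sA
wherever β ≠ 0 (`ricOp_comp_self`).

To reach the zeros of β, note that B = A and B = A² − sA satisfy ∇B = kβ ⊗ B with k = 1 and k = 2.
The function h = tr B² then solves dh = 2kβh, so by Grönwall a zero of h spreads to a neighbourhood
(`exists_nhds_eq_zero_iff`); connectedness makes the vanishing of B all or nothing
(`forall_of_chart_locallyConstant`). Hence A vanishes nowhere and A² = sA everywhere. Taking traces
gives 2|Ri|² = sc², so sc ≠ 0; s⁻¹A is a projection of trace 2, which gives the multiplicities; the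
trace of ∇A = β ⊗ A is d sc = sc β.

The tensor calculus is carried out for a metric G on an open subset of a vector space; charts then
translate the definitions on M. -/

open scoped Topology

set_option linter.unusedSectionVars false

/-! Shortcut instances for spaces of continuous bilinear and trilinear maps. -/
namespace BilinInstances

noncomputable section

variable (E F : Type*) [NormedAddCommGroup E] [NormedSpace ℝ E]
  [NormedAddCommGroup F] [NormedSpace ℝ F]

scoped instance instNormedAddCommGroupBilin : NormedAddCommGroup (E →L[ℝ] E →L[ℝ] F) :=
  inferInstance
scoped instance instNormedSpaceBilin : NormedSpace ℝ (E →L[ℝ] E →L[ℝ] F) := inferInstance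
scoped instance instAddCommGroupBilin : AddCommGroup (E →L[ℝ] E →L[ℝ] F) := inferInstance
scoped instance instAddCommMonoidBilin : AddCommMonoid (E →L[ℝ] E →L[ℝ] F) := inferInstance
scoped instance instTopologicalSpaceBilin : TopologicalSpace (E →L[ℝ] E →L[ℝ] F) := inferInstance
scoped instance instModuleBilin : Module ℝ (E →L[ℝ] E →L[ℝ] F) := inferInstance
scoped instance instNormedAddCommGroupTrilin : NormedAddCommGroup (E →L[ℝ] E →L[ℝ] E →L[ℝ] F) :=
  inferInstance
scoped instance instNormedSpaceTrilin : NormedSpace ℝ (E →L[ℝ] E →L[ℝ] E →L[ℝ] F) := inferInstance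
scoped instance instAddCommGroupTrilin : AddCommGroup (E →L[ℝ] E →L[ℝ] E →L[ℝ] F) := inferInstance
scoped instance instAddCommMonoidTrilin : AddCommMonoid (E →L[ℝ] E →L[ℝ] E →L[ℝ] F) := inferInstance
scoped instance instTopologicalSpaceTrilin : TopologicalSpace (E →L[ℝ] E →L[ℝ] E →L[ℝ] F) :=
  inferInstance
scoped instance instModuleTrilin : Module ℝ (E →L[ℝ] E →L[ℝ] E →L[ℝ] F) := inferInstance

end

end BilinInstances

section RecurrentRicci

open scoped BilinInstances

/-! ### Product rules for directional derivatives -/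

section LineDeriv

variable {E F F' : Type*} [NormedAddCommGroup E] [NormedSpace ℝ E]
  [NormedAddCommGroup F] [NormedSpace ℝ F] [NormedAddCommGroup F'] [NormedSpace ℝ F']
  {z u : E}

lemma HasLineDerivAt.fun_add {f g : E → F} {f' g' : F} (hf : HasLineDerivAt ℝ f f' z u)
    (hg : HasLineDerivAt ℝ g g' z u) : HasLineDerivAt ℝ (fun y ↦ f y + g y) (f' + g') z u :=
  HasDerivAt.fun_add hf hg

lemma HasLineDerivAt.fun_sub {f g : E → F} {f' g' : F} (hf : HasLineDerivAt ℝ f f' z u)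
    (hg : HasLineDerivAt ℝ g g' z u) : HasLineDerivAt ℝ (fun y ↦ f y - g y) (f' - g') z u :=
  HasDerivAt.fun_sub hf hg

lemma HasLineDerivAt.fun_smul {c : E → ℝ} {f : E → F} {c' : ℝ} {f' : F}
    (hc : HasLineDerivAt ℝ c c' z u) (hf : HasLineDerivAt ℝ f f' z u) :
    HasLineDerivAt ℝ (fun y ↦ c y • f y) (c z • f' + c' • f z) z u := by
  have := HasDerivAt.fun_smul hc hf
  -- A directional derivative is a derivative in t at t = 0 along z + t • u, so the product rule
  -- leaves values at z + 0 • u.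
  rwa [zero_smul, add_zero] at this

lemma HasLineDerivAt.clm_apply {c : E → F →L[ℝ] F'} {f : E → F} {c' : F →L[ℝ] F'} {f' : F}
    (hc : HasLineDerivAt ℝ c c' z u) (hf : HasLineDerivAt ℝ f f' z u) :
    HasLineDerivAt ℝ (fun y ↦ c y (f y)) (c' (f z) + c z f') z u := by
  have := HasDerivAt.clm_apply hc hf
  rwa [zero_smul, add_zero] at this

lemma hasLineDerivAt_const (c : F) : HasLineDerivAt ℝ (fun _ : E ↦ c) 0 z u :=
  hasDerivAt_const _ _

lemma HasLineDerivAt.clm_const {c : E → F →L[ℝ] F'} {c' : F →L[ℝ] F'}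
    (hc : HasLineDerivAt ℝ c c' z u) (a : F) : HasLineDerivAt ℝ (fun y ↦ c y a) (c' a) z u := by
  simpa using hc.clm_apply (hasLineDerivAt_const a)

lemma HasLineDerivAt.const_clm (L : F →L[ℝ] F') {f : E → F} {f' : F}
    (hf : HasLineDerivAt ℝ f f' z u) : HasLineDerivAt ℝ (fun y ↦ L (f y)) (L f') z u := by
  simpa using (hasLineDerivAt_const L).clm_apply hf

lemma DifferentiableAt.hasLineDerivAt_fderiv {f : E → F} (hf : DifferentiableAt ℝ f z) (u : E) :
    HasLineDerivAt ℝ f (fderiv ℝ f z u) z u :=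
  hf.hasFDerivAt.hasLineDerivAt u

/-- Two functions which agree on an open set have the same directional derivatives there. -/
lemma HasLineDerivAt.unique_of_eqOn {f g : E → F} {f' g' : F} {V : Set E} (hV : IsOpen V)
    (hz : z ∈ V) (hf : HasLineDerivAt ℝ f f' z u) (hg : HasLineDerivAt ℝ g g' z u)
    (h : Set.EqOn f g V) : f' = g' :=
  hf.unique (hg.congr_of_eventuallyEq (h.eventuallyEq_of_mem (hV.mem_nhds hz)))

end LineDeriv

/-! ### Riemannian metrics on open subsets of a vector space -/

variable {E : Type*} [NormedAddCommGroup E] [NormedSpace ℝ E] [FiniteDimensional ℝ E]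

/-- `G` is a smooth Riemannian metric on the open subset `V` of the vector space `E`. -/
structure IsMetricOn (G : E → E →L[ℝ] E →L[ℝ] ℝ) (V : Set E) : Prop where
  isOpen : IsOpen V
  contDiffOn : ContDiffOn ℝ ∞ G V
  symm : ∀ z ∈ V, ∀ a b, G z a b = G z b a
  pos : ∀ z ∈ V, ∀ a, a ≠ 0 → 0 < G z a a

/-! ### Christoffel symbols, curvature and Ricci tensor in coordinates -/

noncomputable section

/-- The trace of an endomorphism as a continuous linear form. -/
def traceCLM (E : Type*) [NormedAddCommGroup E] [NormedSpace ℝ E] [FiniteDimensional ℝ E] :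
    (E →L[ℝ] E) →L[ℝ] ℝ :=
  LinearMap.toContinuousLinearMap
    ((LinearMap.trace ℝ E).comp (ContinuousLinearMap.coeLM ℝ))

lemma traceCLM_apply (T : E →L[ℝ] E) : traceCLM E T = LinearMap.trace ℝ E T.toLinearMap := rfl

lemma traceCLM_comp_comm (S T : E →L[ℝ] E) : traceCLM E (S ∘L T) = traceCLM E (T ∘L S) :=
  LinearMap.trace_mul_comm ℝ S.toLinearMap T.toLinearMap

namespace ChartMetric

/-- The trilinear form `2 ⟨Γ(a, b), c⟩` of first order derivatives of the metric. -/
def christoffelForm (G : E → E →L[ℝ] E →L[ℝ] ℝ) (z : E) : E →L[ℝ] E →L[ℝ] E →L[ℝ] ℝ :=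
  fderiv ℝ G z + (fderiv ℝ G z).flip
    - ((ContinuousLinearMap.flipₗᵢ ℝ E E ℝ : (E →L[ℝ] E →L[ℝ] ℝ) →L[ℝ] E →L[ℝ] E →L[ℝ] ℝ)
      ∘L (fderiv ℝ G z).flip)

set_option synthInstance.maxHeartbeats 200000 in
/-- The Christoffel symbol `Γ(a, b)` of a metric on an open subset of a vector space. -/
def christoffel (G : E → E →L[ℝ] E →L[ℝ] ℝ) (z : E) : E →L[ℝ] E →L[ℝ] E :=
  (ContinuousLinearMap.compL ℝ E (E →L[ℝ] ℝ) E (G z).inverse) ∘L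
    ((1 / 2 : ℝ) • christoffelForm G z)

/-- The non-antisymmetrised curvature `DΓ(a)(b, c) + Γ(a, Γ(b, c))`. -/
def preCurv (G : E → E →L[ℝ] E →L[ℝ] ℝ) (z : E) : E →L[ℝ] E →L[ℝ] E →L[ℝ] E :=
  fderiv ℝ (christoffel G) z +
    (ContinuousLinearMap.compL ℝ E E E).bilinearComp (christoffel G z) (christoffel G z)

/-- The curvature `R(a, b) c` of a metric on an open subset of a vector space. -/
def curv (G : E → E →L[ℝ] E →L[ℝ] ℝ) (z : E) : E →L[ℝ] E →L[ℝ] E →L[ℝ] E :=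
  preCurv G z - (preCurv G z).flip

/-- The Ricci tensor `Ric(a, b) = tr (x ↦ R(x, a) b)`. -/
def ric (G : E → E →L[ℝ] E →L[ℝ] ℝ) (z : E) : E →L[ℝ] E →L[ℝ] ℝ :=
  (ContinuousLinearMap.compL ℝ E (E →L[ℝ] E) ℝ (traceCLM E)) ∘L
    ((ContinuousLinearMap.flipₗᵢ ℝ E E E : (E →L[ℝ] E →L[ℝ] E) →L[ℝ] E →L[ℝ] E →L[ℝ] E)
      ∘L (curv G z).flip)

/-- The Ricci tensor as an endomorphism. -/
def ricOp (G : E → E →L[ℝ] E →L[ℝ] ℝ) (z : E) : E →L[ℝ] E :=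
  (G z).inverse ∘L ric G z

variable {G : E → E →L[ℝ] E →L[ℝ] ℝ} {V : Set E} {z : E}

lemma christoffelForm_apply (a b c : E) : christoffelForm G z a b c =
    fderiv ℝ G z a b c + fderiv ℝ G z b a c - fderiv ℝ G z c a b := rfl

lemma curv_apply (a b c : E) : curv G z a b c =
    fderiv ℝ (christoffel G) z a b c - fderiv ℝ (christoffel G) z b a c
      + christoffel G z a (christoffel G z b c) - christoffel G z b (christoffel G z a c) := by
  simp [curv, preCurv]
  abel

lemma curv_swap (a b c : E) : curv G z a b c = - curv G z b a c := by
  simp [curv]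

lemma ric_apply (a b : E) : ric G z a b = traceCLM E (((curv G z).flip a).flip b) := rfl

end ChartMetric

namespace IsMetricOn
open ChartMetric

variable {G : E → E →L[ℝ] E →L[ℝ] ℝ} {V : Set E} {z : E}

lemma contDiffAt (hG : IsMetricOn G V) (hz : z ∈ V) : ContDiffAt ℝ ∞ G z :=
  hG.contDiffOn.contDiffAt (hG.isOpen.mem_nhds hz)

lemma eq_of_forall (hG : IsMetricOn G V) (hz : z ∈ V) {a b : E}
    (h : ∀ c, G z a c = G z b c) : a = b := by
  by_contra hab
  have h1 := hG.pos z hz (a - b) (sub_ne_zero.2 hab)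
  simp [h] at h1

lemma isInvertible (hG : IsMetricOn G V) (hz : z ∈ V) : (G z).IsInvertible := by
  have hinj : Function.Injective (G z).toLinearMap :=
    fun a b h ↦ hG.eq_of_forall hz fun c ↦ by exact DFunLike.congr_fun h c
  have hfr : finrank ℝ E = finrank ℝ (E →L[ℝ] ℝ) :=
    (Subspace.dual_finrank_eq (K := ℝ) (V := E)).symm.trans
      (LinearMap.toContinuousLinearMap (𝕜 := ℝ) (E := E) (F' := ℝ)).finrank_eq
  exact ⟨(LinearEquiv.ofInjectiveOfFinrankEq (G z).toLinearMap hinj hfr).toContinuousLinearEquiv,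
    by ext; rfl⟩

lemma apply_inverse (hG : IsMetricOn G V) (hz : z ∈ V) (l : E →L[ℝ] ℝ) (c : E) :
    G z ((G z).inverse l) c = l c := by
  rw [(hG.isInvertible hz).self_apply_inverse]

lemma apply_christoffel (hG : IsMetricOn G V) (hz : z ∈ V) (a b c : E) :
    G z (christoffel G z a b) c =
      (fderiv ℝ G z a b c + fderiv ℝ G z b a c - fderiv ℝ G z c a b) / 2 := by
  have : christoffel G z a b = (G z).inverse ((1 / 2 : ℝ) • christoffelForm G z a b) := by
    simp [christoffel]
  rw [this, hG.apply_inverse hz]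
  simp [christoffelForm_apply]
  ring

lemma apply_ricOp (hG : IsMetricOn G V) (hz : z ∈ V) (a b : E) :
    G z (ricOp G z a) b = ric G z a b :=
  hG.apply_inverse hz _ _

lemma contDiffOn_fderiv (hV : IsOpen V) {F : Type*} [NormedAddCommGroup F] [NormedSpace ℝ F]
    {f : E → F} (hf : ContDiffOn ℝ ∞ f V) : ContDiffOn ℝ ∞ (fderiv ℝ f) V :=
  hf.fderiv_of_isOpen hV (by simp)

lemma contDiffOn_inverse (hG : IsMetricOn G V) :
    ContDiffOn ℝ ∞ (fun z ↦ (G z).inverse) V := by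
  intro z hz
  obtain ⟨e, he⟩ := hG.isInvertible hz
  have := contDiffAt_map_inverse (𝕜 := ℝ) (n := ∞) e
  rw [he] at this
  exact (this.comp z (hG.contDiffAt hz)).contDiffWithinAt

lemma contDiffOn_christoffel (hG : IsMetricOn G V) : ContDiffOn ℝ ∞ (christoffel G) V := by
  have hD := contDiffOn_fderiv hG.isOpen hG.contDiffOn
  have hi := hG.contDiffOn_inverse
  have h (a b : E) : ContDiffOn ℝ ∞ (fun z ↦ christoffelForm G z a b) V := by
    refine contDiffOn_clm_apply.2 fun c ↦ ?_
    simp only [christoffelForm_apply]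
    fun_prop
  refine contDiffOn_clm_apply.2 fun a ↦ contDiffOn_clm_apply.2 fun b ↦ ?_
  have : (fun z ↦ christoffel G z a b) =
      fun z ↦ (G z).inverse ((1 / 2 : ℝ) • christoffelForm G z a b) := by
    ext z; simp [christoffel]
  rw [this]
  have := h a b
  fun_prop

lemma contDiffOn_curv (hG : IsMetricOn G V) : ContDiffOn ℝ ∞ (curv G) V := by
  have hΓ := hG.contDiffOn_christoffel
  have hD := contDiffOn_fderiv hG.isOpen hΓ
  refine contDiffOn_clm_apply.2 fun a ↦ contDiffOn_clm_apply.2 fun b ↦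
    contDiffOn_clm_apply.2 fun c ↦ ?_
  simp only [curv_apply]
  fun_prop

lemma contDiffOn_ric (hG : IsMetricOn G V) : ContDiffOn ℝ ∞ (ric G) V := by
  have hR := hG.contDiffOn_curv
  refine contDiffOn_clm_apply.2 fun a ↦ contDiffOn_clm_apply.2 fun b ↦ ?_
  simp only [ric_apply]
  refine (traceCLM E).contDiff.comp_contDiffOn (contDiffOn_clm_apply.2 fun c ↦ ?_)
  simp only [ContinuousLinearMap.flip_apply]
  fun_prop

lemma contDiffOn_ricOp (hG : IsMetricOn G V) : ContDiffOn ℝ ∞ (ricOp G) V := by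
  have hR := hG.contDiffOn_ric
  have hi := hG.contDiffOn_inverse
  unfold ricOp
  fun_prop

end IsMetricOn
end

/-! ### Symmetries of the curvature and the Bianchi identities -/

section

variable {E : Type*} [NormedAddCommGroup E] [NormedSpace ℝ E] [FiniteDimensional ℝ E]

namespace IsMetricOn
open ChartMetric

variable {G : E → E →L[ℝ] E →L[ℝ] ℝ} {V : Set E} {z : E}

section Identities

variable (hG : IsMetricOn G V) (hz : z ∈ V)
include hG hz

lemma differentiableAt_of_contDiffOn {F : Type*} [NormedAddCommGroup F] [NormedSpace ℝ F]
    {f : E → F} (hf : ContDiffOn ℝ ∞ f V) : DifferentiableAt ℝ f z :=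
  (hf.contDiffAt (hG.isOpen.mem_nhds hz)).differentiableAt (by simp)

lemma hasLineDerivAt (u : E) : HasLineDerivAt ℝ G (fderiv ℝ G z u) z u :=
  (hG.differentiableAt_of_contDiffOn hz hG.contDiffOn).hasLineDerivAt_fderiv u

lemma hasLineDerivAt_fderiv (u : E) :
    HasLineDerivAt ℝ (fderiv ℝ G) (fderiv ℝ (fderiv ℝ G) z u) z u :=
  (hG.differentiableAt_of_contDiffOn hz
    (contDiffOn_fderiv hG.isOpen hG.contDiffOn)).hasLineDerivAt_fderiv u

lemma hasLineDerivAt_christoffel (u : E) :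
    HasLineDerivAt ℝ (christoffel G) (fderiv ℝ (christoffel G) z u) z u :=
  (hG.differentiableAt_of_contDiffOn hz hG.contDiffOn_christoffel).hasLineDerivAt_fderiv u

lemma hasLineDerivAt_fderiv_christoffel (u : E) :
    HasLineDerivAt ℝ (fderiv ℝ (christoffel G)) (fderiv ℝ (fderiv ℝ (christoffel G)) z u) z u :=
  (hG.differentiableAt_of_contDiffOn hz
    (contDiffOn_fderiv hG.isOpen hG.contDiffOn_christoffel)).hasLineDerivAt_fderiv u

lemma hasLineDerivAt_curv (u : E) : HasLineDerivAt ℝ (curv G) (fderiv ℝ (curv G) z u) z u :=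
  (hG.differentiableAt_of_contDiffOn hz hG.contDiffOn_curv).hasLineDerivAt_fderiv u

lemma hasLineDerivAt_ric (u : E) : HasLineDerivAt ℝ (ric G) (fderiv ℝ (ric G) z u) z u :=
  (hG.differentiableAt_of_contDiffOn hz hG.contDiffOn_ric).hasLineDerivAt_fderiv u

lemma hasLineDerivAt_ricOp (u : E) : HasLineDerivAt ℝ (ricOp G) (fderiv ℝ (ricOp G) z u) z u :=
  (hG.differentiableAt_of_contDiffOn hz hG.contDiffOn_ricOp).hasLineDerivAt_fderiv u

lemma fderiv_fderiv_symm {F : Type*} [NormedAddCommGroup F] [NormedSpace ℝ F]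
    {f : E → F} (hf : ContDiffOn ℝ ∞ f V) (u a : E) :
    fderiv ℝ (fderiv ℝ f) z u a = fderiv ℝ (fderiv ℝ f) z a u :=
  (hf.contDiffAt (hG.isOpen.mem_nhds hz)).isSymmSndFDerivAt
    (by simpa using (WithTop.coe_le_coe.2 le_top : ((2 : ℕ∞) : WithTop ℕ∞) ≤ ∞)) u a

lemma fderiv_symm (u a b : E) : fderiv ℝ G z u a b = fderiv ℝ G z u b a :=
  HasLineDerivAt.unique_of_eqOn hG.isOpen hz (((hG.hasLineDerivAt hz u).clm_const a).clm_const b)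
    (((hG.hasLineDerivAt hz u).clm_const b).clm_const a) fun y hy ↦ hG.symm y hy a b

/-- The Levi-Civita connection is torsion free. -/
lemma christoffel_symm (a b : E) : christoffel G z a b = christoffel G z b a :=
  hG.eq_of_forall hz fun c ↦ by
    rw [hG.apply_christoffel hz, hG.apply_christoffel hz, hG.fderiv_symm hz c]
    ring

/-- The Levi-Civita connection is compatible with the metric. -/
lemma fderiv_apply (a b c : E) : fderiv ℝ G z a b c =
    G z (christoffel G z a b) c + G z b (christoffel G z a c) := by
  rw [hG.symm z hz b, hG.apply_christoffel hz, hG.apply_christoffel hz, hG.fderiv_symm hz a c,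
    hG.fderiv_symm hz b, hG.fderiv_symm hz c]
  ring

lemma fderiv_christoffel_symm (u a b : E) :
    fderiv ℝ (christoffel G) z u a b = fderiv ℝ (christoffel G) z u b a :=
  HasLineDerivAt.unique_of_eqOn hG.isOpen hz
    (((hG.hasLineDerivAt_christoffel hz u).clm_const a).clm_const b)
    (((hG.hasLineDerivAt_christoffel hz u).clm_const b).clm_const a)
    fun _ hy ↦ hG.christoffel_symm hy a b

lemma fderiv_fderiv_apply (u a b c : E) : fderiv ℝ (fderiv ℝ G) z u a b c =
    fderiv ℝ G z u (christoffel G z a b) c + G z (fderiv ℝ (christoffel G) z u a b) c +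
      (fderiv ℝ G z u b (christoffel G z a c) + G z b (fderiv ℝ (christoffel G) z u a c)) := by
  have hΓ (b : E) := ((hG.hasLineDerivAt_christoffel hz u).clm_const a).clm_const b
  have h := HasLineDerivAt.unique_of_eqOn hG.isOpen hz
    ((((hG.hasLineDerivAt_fderiv hz u).clm_const a).clm_const b).clm_const c)
    ((((hG.hasLineDerivAt hz u).clm_apply (hΓ b)).clm_const c).fun_add
      (((hG.hasLineDerivAt hz u).clm_const b).clm_apply (hΓ c)))
    fun y hy ↦ hG.fderiv_apply hy a b c
  simpa using h

/-- The curvature is skew-symmetric in the last pair of arguments. -/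
lemma curv_skew (a b c d : E) : G z (curv G z a b c) d = - G z c (curv G z a b d) := by
  have h1 := hG.fderiv_fderiv_apply hz a b c d
  have h2 := hG.fderiv_fderiv_apply hz b a c d
  -- The second derivatives of G commute. Once first derivatives of G are expanded by metric
  -- compatibility, this symmetry is exactly the skewness of R(a, b).
  rw [hG.fderiv_fderiv_symm hz hG.contDiffOn, h2] at h1
  simp only [hG.fderiv_apply hz] at h1
  simp only [curv_apply, map_add, map_sub, add_apply, sub_apply]
  linear_combination -h1

/-- The first Bianchi identity. -/
lemma curv_bianchi (a b c : E) : curv G z a b c + curv G z b c a + curv G z c a b = 0 := by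
  simp only [curv_apply]
  rw [hG.fderiv_christoffel_symm hz a c b, hG.fderiv_christoffel_symm hz b a c,
    hG.fderiv_christoffel_symm hz c b a, hG.christoffel_symm hz c a, hG.christoffel_symm hz c b,
    hG.christoffel_symm hz b a]
  abel

/-- The pair symmetry of the curvature. -/
lemma curv_pair_symm (a b c d : E) : G z (curv G z a b c) d = G z (curv G z c d a) b := by
  have hb (a b c d : E) := congr($(congrArg (G z) (hG.curv_bianchi hz a b c)) d)
  simp only [map_add, add_apply, map_zero, zero_apply] at hb
  have hs (a b c d : E) : G z (curv G z a b c) d = - G z (curv G z a b d) c := by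
    rw [hG.curv_skew hz, hG.symm z hz]
  have hw (a b c d : E) : G z (curv G z a b c) d = - G z (curv G z b a c) d := by
    rw [curv_swap]; simp
  -- Octahedron argument: writing B for the Bianchi sum `hb`, the combination B(a,b,c,d) +
  -- B(b,c,d,a) − B(c,d,a,b) − B(d,a,b,c) reduces by the two skewnesses to 2R(a,b,c,d) −
  -- 2R(c,d,a,b).
  linarith [hb a b c d, hb b c d a, hb c d a b, hb d a b c, hs a b c d, hs b c a d, hs c a b d,
    hs b c d a, hs c d b a, hs d b c a, hs c d a b, hs d a c b, hs a c d b, hs d a b c,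
    hs a b d c, hs b d a c, hw a c b d, hw b d a c, hw a c d b, hw b d c a, hw c a b d,
    hw d b c a, hw a b c d, hw c d a b, hw b c a d, hw d a c b]

lemma fderiv_curv_apply (u a b c : E) : fderiv ℝ (curv G) z u a b c =
    fderiv ℝ (fderiv ℝ (christoffel G)) z u a b c - fderiv ℝ (fderiv ℝ (christoffel G)) z u b a c
      + (fderiv ℝ (christoffel G) z u a (christoffel G z b c)
        + christoffel G z a (fderiv ℝ (christoffel G) z u b c))
      - (fderiv ℝ (christoffel G) z u b (christoffel G z a c)
        + christoffel G z b (fderiv ℝ (christoffel G) z u a c)) := by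
  have hΓ := hG.hasLineDerivAt_christoffel hz u
  have hD := hG.hasLineDerivAt_fderiv_christoffel hz u
  exact HasLineDerivAt.unique_of_eqOn hG.isOpen hz
    ((((hG.hasLineDerivAt_curv hz u).clm_const a).clm_const b).clm_const c)
    ((((((hD.clm_const a).clm_const b).clm_const c).fun_sub
      (((hD.clm_const b).clm_const a).clm_const c)).fun_add
      ((hΓ.clm_const a).clm_apply ((hΓ.clm_const b).clm_const c))).fun_sub
      ((hΓ.clm_const b).clm_apply ((hΓ.clm_const a).clm_const c)))
    fun y _ ↦ curv_apply a b c

end Identities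

end IsMetricOn

namespace ChartMetric

/-- The covariant derivative `(∇_u R)(a, b) c` of the curvature. -/
noncomputable def covCurv (G : E → E →L[ℝ] E →L[ℝ] ℝ) (z u a b c : E) : E :=
  fderiv ℝ (curv G) z u a b c + christoffel G z u (curv G z a b c)
    - curv G z (christoffel G z u a) b c - curv G z a (christoffel G z u b) c
    - curv G z a b (christoffel G z u c)

end ChartMetric

namespace IsMetricOn
open ChartMetric

variable {G : E → E →L[ℝ] E →L[ℝ] ℝ} {V : Set E} {z : E}
variable (hG : IsMetricOn G V) (hz : z ∈ V)
include hG hz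

/-- The second Bianchi identity. -/
lemma covCurv_bianchi (u a b c : E) :
    covCurv G z u a b c + covCurv G z a b u c + covCurv G z b u a c = 0 := by
  have hS (u a b c : E) := congr($(hG.fderiv_fderiv_symm hz hG.contDiffOn_christoffel u a) b c)
  simp only [covCurv]
  rw [curv_swap a (christoffel G z u b), curv_swap b (christoffel G z a u),
    curv_swap u (christoffel G z b a), hG.christoffel_symm hz a u, hG.christoffel_symm hz b a,
    hG.christoffel_symm hz b u]
  -- The six terms with a Christoffel symbol in one of the first two slots of R now cancel in pairs,
  -- so they stay atoms; only the rest is expanded.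
  generalize curv G z (christoffel G z u a) b c = r₁
  generalize curv G z (christoffel G z u b) a c = r₂
  generalize curv G z (christoffel G z a b) u c = r₃
  simp only [hG.fderiv_curv_apply hz, curv_apply, map_add, map_sub]
  rw [hS u a b c, hS b u a c, hS a b u c]
  abel

lemma covCurv_swap (u a b c : E) : covCurv G z u a b c = - covCurv G z u b a c := by
  simp only [covCurv, hG.fderiv_curv_apply hz]
  rw [curv_swap a b c, curv_swap (christoffel G z u a), curv_swap a (christoffel G z u b),
    curv_swap a b (christoffel G z u c)]
  simp only [map_neg]
  abel

/-- The metric is parallel, so differentiating the skewness of R gives that of ∇R. -/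
lemma covCurv_skew (u a b c d : E) :
    G z (covCurv G z u a b c) d = - G z c (covCurv G z u a b d) := by
  have hR (c : E) := (((hG.hasLineDerivAt_curv hz u).clm_const a).clm_const b).clm_const c
  have h0 := HasLineDerivAt.unique_of_eqOn hG.isOpen hz
    ((((hG.hasLineDerivAt hz u).clm_apply (hR c)).clm_const d).fun_add
      (((hG.hasLineDerivAt hz u).clm_const c).clm_apply (hR d)))
    (hasLineDerivAt_const (0 : ℝ)) fun y hy ↦ by simp [hG.curv_skew hy a b c d]
  simp only [add_apply, hG.fderiv_apply hz] at h0
  simp only [covCurv, map_add, map_sub, add_apply, sub_apply]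
  linear_combination h0 - hG.curv_skew hz (christoffel G z u a) b c d
    - hG.curv_skew hz a (christoffel G z u b) c d
    - hG.curv_skew hz a b (christoffel G z u c) d - hG.curv_skew hz a b c (christoffel G z u d)

end IsMetricOn

end

/-! ### Orthonormal bases, traces and the Ricci tensor -/

section

variable {E : Type*} [NormedAddCommGroup E] [NormedSpace ℝ E] [FiniteDimensional ℝ E]

namespace ChartMetric

/-- The basis `e` is orthonormal for the metric `G` at the point `z`. -/
def IsOrthonormalAt {ι : Type*} [DecidableEq ι] (G : E → E →L[ℝ] E →L[ℝ] ℝ) (z : E)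
    (e : Basis ι ℝ E) : Prop :=
  ∀ i j, G z (e i) (e j) = if i = j then 1 else 0

variable {ι : Type*} [DecidableEq ι] [Fintype ι] {G : E → E →L[ℝ] E →L[ℝ] ℝ} {z : E}
  {e : Basis ι ℝ E}

lemma IsOrthonormalAt.repr_apply (he : IsOrthonormalAt G z e) (v : E) (i : ι) :
    e.repr v i = G z v (e i) := by
  conv_rhs => rw [← e.sum_repr v]
  simp only [map_sum, map_smul, sum_apply, smul_apply, smul_eq_mul, he _ i]
  simp

lemma IsOrthonormalAt.sum_apply_smul (he : IsOrthonormalAt G z e) (v : E) :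
    ∑ i, G z v (e i) • e i = v := by
  simp_rw [← he.repr_apply]
  exact e.sum_repr v

lemma IsOrthonormalAt.sum_apply_mul (he : IsOrthonormalAt G z e) (v w : E) :
    ∑ i, G z v (e i) * G z (e i) w = G z v w := by
  conv_rhs => rw [← he.sum_apply_smul v]
  simp

lemma IsOrthonormalAt.traceCLM_eq (he : IsOrthonormalAt G z e) (T : E →L[ℝ] E) :
    traceCLM E T = ∑ i, G z (T (e i)) (e i) := by
  simp [traceCLM_apply, LinearMap.trace_eq_matrix_trace ℝ e, Matrix.trace, Matrix.diag,
    LinearMap.toMatrix_apply, he.repr_apply]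

lemma IsOrthonormalAt.ric_eq (he : IsOrthonormalAt G z e) (v w : E) :
    ric G z v w = ∑ i, G z (curv G z (e i) v w) (e i) := by
  simp [ric_apply, he.traceCLM_eq]

/-- The basis is arbitrary and does not depend on the point y. This allows the trace to be
differentiated without moving a frame, although a basis is orthonormal at a single point only. -/
lemma ric_eq_sum_repr (e : Basis ι ℝ E) (y v w : E) :
    ric G y v w = ∑ i, e.coord i (curv G y (e i) v w) := by
  simp [ric_apply, traceCLM_apply, LinearMap.trace_eq_matrix_trace ℝ e, Matrix.trace, Matrix.diag,
    LinearMap.toMatrix_apply]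

end ChartMetric

namespace IsMetricOn
open ChartMetric

variable {ι : Type*} [DecidableEq ι] [Fintype ι] {e : Basis ι ℝ E}
  {G : E → E →L[ℝ] E →L[ℝ] ℝ} {V : Set E} {z : E}
variable (hG : IsMetricOn G V) (hz : z ∈ V)
include hG hz

omit [DecidableEq ι] [Fintype ι] in
lemma exists_isOrthonormalAt :
    ∃ e : Basis (Fin (finrank ℝ E)) ℝ E, IsOrthonormalAt G z e := by
  obtain ⟨v, hv⟩ := LinearMap.BilinForm.exists_orthogonal_basis
    (B := (ContinuousLinearMap.coeLM ℝ ∘ₗ (G z).toLinearMap : LinearMap.BilinForm ℝ E))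
    ⟨fun a b ↦ hG.symm z hz a b⟩
  have hpos (i) : 0 < G z (v i) (v i) := hG.pos z hz _ (v.ne_zero i)
  have hu (i) : IsUnit (√(G z (v i) (v i)))⁻¹ :=
    (inv_ne_zero (Real.sqrt_ne_zero'.2 (hpos i))).isUnit
  refine ⟨v.isUnitSMul hu, fun i j ↦ ?_⟩
  simp only [Basis.isUnitSMul_apply, map_smul, smul_apply, smul_eq_mul]
  split_ifs with hij
  · subst hij
    rw [← mul_assoc, ← mul_inv, Real.mul_self_sqrt (hpos i).le, inv_mul_cancel₀ (hpos i).ne']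
  · have : G z (v i) (v j) = 0 := hv hij
    simp [this]

omit [DecidableEq ι] [Fintype ι] in
lemma ric_symm (v w : E) : ric G z v w = ric G z w v := by
  obtain ⟨e, he⟩ := hG.exists_isOrthonormalAt hz
  simp only [he.ric_eq]
  refine Finset.sum_congr rfl fun i _ ↦ ?_
  rw [hG.curv_pair_symm hz, hG.curv_skew hz, curv_swap w, hG.symm z hz]
  simp

omit [DecidableEq ι] [Fintype ι] in
lemma ricOp_symm (v w : E) :
    G z (ricOp G z v) w = G z v (ricOp G z w) := by
  rw [hG.apply_ricOp hz, hG.symm z hz v, hG.apply_ricOp hz, hG.ric_symm hz]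

omit [DecidableEq ι] [Fintype ι] in
/-- A symmetric endomorphism is zero if the trace of its square is. -/
lemma eq_zero_of_traceCLM_comp_self {B : E →L[ℝ] E} (hB : ∀ v w, G z (B v) w = G z v (B w))
    (h : traceCLM E (B ∘L B) = 0) : B = 0 := by
  obtain ⟨e, he⟩ := hG.exists_isOrthonormalAt hz
  have hnonneg (v : E) : 0 ≤ G z v v := by
    rcases eq_or_ne v 0 with rfl | hv
    · simp
    · exact (hG.pos z hz v hv).le
  simp only [he.traceCLM_eq, ContinuousLinearMap.comp_apply, hB (B _)] at h
  rw [Finset.sum_eq_zero_iff_of_nonneg fun i _ ↦ hnonneg _] at h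
  have h0 : ∀ i, B (e i) = 0 := fun i ↦ by
    by_contra hne
    exact (hG.pos z hz _ hne).ne' (h i (Finset.mem_univ i))
  exact ContinuousLinearMap.coe_injective (e.ext fun i ↦ by simpa using h0 i)

lemma fderiv_ric_apply (he : IsOrthonormalAt G z e) (u v w : E) :
    fderiv ℝ (ric G) z u v w = ∑ i, G z (fderiv ℝ (curv G) z u (e i) v w) (e i) := by
  have hR (i : ι) := (((hG.hasLineDerivAt_curv hz u).clm_const (e i)).clm_const v).clm_const w
  have hsum : HasLineDerivAt ℝ (fun y ↦ ric G y v w)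
      (∑ i, e.coord i (fderiv ℝ (curv G) z u (e i) v w)) z u := by
    simp only [ric_eq_sum_repr e]
    exact HasDerivAt.fun_sum fun i _ ↦ (hR i).const_clm (e.coord i).toContinuousLinearMap
  rw [HasLineDerivAt.unique (((hG.hasLineDerivAt_ric hz u).clm_const v).clm_const w) hsum]
  simp [he.repr_apply]

/-- The covariant derivative of the Ricci tensor is the trace of that of the curvature. -/
lemma sum_covCurv (he : IsOrthonormalAt G z e) (u v w : E) :
    ∑ i, G z (covCurv G z u (e i) v w) (e i) = fderiv ℝ (ric G) z u v w
      - ric G z (christoffel G z u v) w - ric G z v (christoffel G z u w) := by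
  -- By cyclicity of the trace, the terms Γ(u, R(eᵢ, v)w) and R(Γ(u, eᵢ), v)w of ∇R cancel after
  -- summation.
  have h := traceCLM_comp_comm (christoffel G z u) (((curv G z).flip v).flip w)
  simp only [he.traceCLM_eq, ContinuousLinearMap.comp_apply, ContinuousLinearMap.flip_apply] at h
  simp only [covCurv, map_add, map_sub, add_apply, sub_apply, Finset.sum_add_distrib,
    Finset.sum_sub_distrib, he.ric_eq, hG.fderiv_ric_apply hz he, h]
  ring

end IsMetricOn

/-! ### Consequences of recurrence in coordinates -/

/-- The Ricci tensor of the metric `G` on the open set `V` is recurrent with differentiable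
recurrence form `β`. -/
structure IsRecurrentOn (G : E → E →L[ℝ] E →L[ℝ] ℝ) (β : E → E →L[ℝ] ℝ) (V : Set E) : Prop
    extends IsMetricOn G V where
  differentiableAt : ∀ z ∈ V, DifferentiableAt ℝ β z
  recurrent : ∀ z ∈ V, ∀ u v w, fderiv ℝ (ChartMetric.ric G) z u v w
      - ChartMetric.ric G z (ChartMetric.christoffel G z u v) w
      - ChartMetric.ric G z v (ChartMetric.christoffel G z u w) = β z u * ChartMetric.ric G z v w

namespace ChartMetric

/-- The endomorphism field `B` satisfies `∇ B = k β ⊗ B` at the point `z`. -/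
def IsRecurrentEnd (G : E → E →L[ℝ] E →L[ℝ] ℝ) (β : E → E →L[ℝ] ℝ) (k : ℝ)
    (B : E → E →L[ℝ] E) (z : E) : Prop :=
  ∀ u, HasLineDerivAt ℝ B ((k * β z u) • B z + B z ∘L christoffel G z u
    - christoffel G z u ∘L B z) z u

variable {G : E → E →L[ℝ] E →L[ℝ] ℝ} {β : E → E →L[ℝ] ℝ} {k l : ℝ} {B C : E → E →L[ℝ] E} {z : E}

lemma IsRecurrentEnd.comp (hB : IsRecurrentEnd G β k B z) (hC : IsRecurrentEnd G β l C z) :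
    IsRecurrentEnd G β (k + l) (fun y ↦ B y ∘L C y) z := by
  intro u
  have h := HasDerivAt.clm_comp (hB u) (hC u)
  rw [zero_smul, add_zero] at h
  refine HasDerivAt.congr_deriv h ?_
  ext x
  simp
  module

lemma IsRecurrentEnd.sub (hB : IsRecurrentEnd G β k B z) (hC : IsRecurrentEnd G β k C z) :
    IsRecurrentEnd G β k (fun y ↦ B y - C y) z := by
  intro u
  refine HasDerivAt.congr_deriv ((hB u).fun_sub (hC u)) ?_
  ext x
  simp
  module

/-- The commutator with Γ(u, ·) has trace zero, so the trace obeys a scalar linear equation free of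
Christoffel symbols. -/
lemma IsRecurrentEnd.trace (hB : IsRecurrentEnd G β k B z) (u : E) :
    HasLineDerivAt ℝ (fun y ↦ traceCLM E (B y)) (k * β z u * traceCLM E (B z)) z u := by
  refine HasDerivAt.congr_deriv ((hB u).const_clm (traceCLM E)) ?_
  rw [map_sub, map_add, map_smul, traceCLM_comp_comm (B z)]
  simp

lemma IsRecurrentEnd.smul {f : E → ℝ}
    (hf : ∀ u, HasLineDerivAt ℝ f (l * β z u * f z) z u) (hB : IsRecurrentEnd G β k B z) :
    IsRecurrentEnd G β (k + l) (fun y ↦ f y • B y) z := by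
  intro u
  refine HasDerivAt.congr_deriv ((hf u).fun_smul (hB u)) ?_
  ext x
  simp
  module

end ChartMetric

namespace IsRecurrentOn
open ChartMetric IsMetricOn

variable {ι : Type*} [DecidableEq ι] [Fintype ι] {e : Basis ι ℝ E}
  {G : E → E →L[ℝ] E →L[ℝ] ℝ} {β : E → E →L[ℝ] ℝ} {V : Set E} {z : E}
variable (h : IsRecurrentOn G β V) (hz : z ∈ V)
include h hz

/-- Raising an index commutes with ∇ because the metric is parallel. Recurrence thus passes to the
endomorphism, which can be composed and traced. -/
lemma fderiv_ricOp (u : E) : fderiv ℝ (ricOp G) z u =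
    β z u • ricOp G z + ricOp G z ∘L christoffel G z u - christoffel G z u ∘L ricOp G z := by
  have hG := h.toIsMetricOn
  ext v
  refine hG.eq_of_forall hz fun w ↦ ?_
  have h1 := HasLineDerivAt.unique_of_eqOn hG.isOpen hz
    (((hG.hasLineDerivAt_ric hz u).clm_const v).clm_const w)
    (((hG.hasLineDerivAt hz u).clm_apply ((hG.hasLineDerivAt_ricOp hz u).clm_const v)).clm_const w)
    fun y hy ↦ (hG.apply_ricOp hy v w).symm
  have h2 := h.recurrent z hz u v w
  simp only [add_apply, hG.fderiv_apply hz] at h1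
  simp only [add_apply, sub_apply, smul_apply, ContinuousLinearMap.comp_apply, map_add, map_sub,
    map_smul, smul_eq_mul, hG.apply_ricOp hz] at h1 h2 ⊢
  linear_combination h2 - h1

lemma isRecurrentEnd_ricOp : IsRecurrentEnd G β 1 (ricOp G) z := fun u ↦ by
  rw [one_mul, ← h.fderiv_ricOp hz]
  exact h.toIsMetricOn.hasLineDerivAt_ricOp hz u

/-- The Ricci identity for the recurrent Ricci tensor. -/
lemma curv_ricOp (a b c : E) :
    curv G z a b (ricOp G z c) - ricOp G z (curv G z a b c) =
      (fderiv ℝ β z a b - fderiv ℝ β z b a) • ricOp G z c := by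
  have hG := h.toIsMetricOn
  have hA (u : E) := hG.hasLineDerivAt_ricOp hz u
  have hΓ (u : E) := hG.hasLineDerivAt_christoffel hz u
  have hβ (u : E) := (h.differentiableAt z hz).hasLineDerivAt_fderiv u
  -- The formula `fderiv_ricOp` is differentiated once more, in the direction u; antisymmetrising in
  -- u and a then removes the second derivative of A and leaves curvature and dβ.
  have key (u a : E) := HasLineDerivAt.unique_of_eqOn hG.isOpen hz
    ((((hG.differentiableAt_of_contDiffOn hz (contDiffOn_fderiv hG.isOpen
      hG.contDiffOn_ricOp)).hasLineDerivAt_fderiv u).clm_const a).clm_const c)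
    ((((hβ u).clm_const a).fun_smul ((hA u).clm_const c)).fun_add
      ((hA u).clm_apply (((hΓ u).clm_const a).clm_const c)) |>.fun_sub
      (((hΓ u).clm_const a).clm_apply ((hA u).clm_const c)))
    fun y hy ↦ by simp [h.fderiv_ricOp hy]
  have h1 := key a b
  rw [hG.fderiv_fderiv_symm hz hG.contDiffOn_ricOp, key b a] at h1
  simp only [h.fderiv_ricOp hz, add_apply, sub_apply, smul_apply, ContinuousLinearMap.comp_apply,
    map_add, map_sub, map_smul] at h1
  simp only [curv_apply, map_add, map_sub]
  rw [← sub_eq_zero] at h1 ⊢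
  rw [← h1]
  module

/-- Composing the Ricci identity with A and tracing kills the commutator, leaving dβ(a,b) · tr A² =
0. As A is symmetric and nonzero, tr A² ≠ 0, hence dβ(a,b) = 0. -/
lemma curv_ricOp_of_ne_zero (hA : ricOp G z ≠ 0) (a b c : E) :
    curv G z a b (ricOp G z c) = ricOp G z (curv G z a b c) := by
  have hG := h.toIsMetricOn
  have h1 : curv G z a b ∘L ricOp G z - ricOp G z ∘L curv G z a b =
      (fderiv ℝ β z a b - fderiv ℝ β z b a) • ricOp G z := by
    ext c
    exact h.curv_ricOp hz a b c
  have h2 := congrArg (fun T ↦ traceCLM E (T ∘L ricOp G z)) h1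
  simp only [ContinuousLinearMap.sub_comp, map_sub, ContinuousLinearMap.smul_comp, map_smul] at h2
  rw [ContinuousLinearMap.comp_assoc (ricOp G z), traceCLM_comp_comm (ricOp G z), sub_self] at h2
  rcases smul_eq_zero.1 h2.symm with h3 | h3
  · have h4 := h.curv_ricOp hz a b c
    rwa [h3, zero_smul, sub_eq_zero] at h4
  · exact absurd (hG.eq_zero_of_traceCLM_comp_self hz (hG.ricOp_symm hz) h3) hA

/-- Pair symmetry turns the commutation of R and A into R(Aa, b) = R(a, Ab). On differentiating, the
terms from ∇A = β ⊗ A are β times this same identity and cancel, so ∇R inherits it. -/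
lemma covCurv_ricOp (hA : ricOp G z ≠ 0) (u a b c : E) :
    covCurv G z u (ricOp G z a) b c = covCurv G z u a (ricOp G z b) c := by
  have hG := h.toIsMetricOn
  have hcont : ContinuousOn (ricOp G) V := hG.contDiffOn_ricOp.continuousOn
  -- The identity is known only where A ≠ 0, so differentiating it requires this set to be open.
  have hopen : IsOpen (V ∩ ricOp G ⁻¹' {0}ᶜ) :=
    hcont.isOpen_inter_preimage hG.isOpen isOpen_compl_singleton
  have key : ∀ y ∈ V ∩ ricOp G ⁻¹' {0}ᶜ, ∀ a b c,
      curv G y (ricOp G y a) b c = curv G y a (ricOp G y b) c := by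
    rintro y ⟨hy, hyA⟩ a b c
    refine hG.eq_of_forall hy fun d ↦ ?_
    rw [hG.curv_pair_symm hy, h.curv_ricOp_of_ne_zero hy hyA, hG.ricOp_symm hy,
      hG.curv_pair_symm hy]
  have hR := hG.hasLineDerivAt_curv hz u
  have hD (a : E) := (hG.hasLineDerivAt_ricOp hz u).clm_const a
  have h1 := HasLineDerivAt.unique_of_eqOn hopen ⟨hz, hA⟩
    (((hR.clm_apply (hD a)).clm_const b).clm_const c)
    (((hR.clm_const a).clm_apply (hD b)).clm_const c) fun y hy ↦ key y hy a b c
  have k := key z ⟨hz, hA⟩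
  simp only [h.fderiv_ricOp hz, add_apply, sub_apply, smul_apply, ContinuousLinearMap.comp_apply,
    map_add, map_sub, map_smul] at h1
  simp only [covCurv]
  linear_combination (norm := module) h1 + congrArg (christoffel G z u) (k a b c)
    - k a (christoffel G z u b) c - k a b (christoffel G z u c) - k (christoffel G z u a) b c
    - β z u • k a b c

/-- The second Bianchi identity, contracted once. -/
lemma sum_covCurv_add (he : IsOrthonormalAt G z e) (u v w : E) :
    β z u * ric G z v w - β z v * ric G z u w
      + ∑ i, G z (covCurv G z (e i) v u w) (e i) = 0 := by
  have hG := h.toIsMetricOn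
  rw [← h.recurrent z hz, ← h.recurrent z hz, ← hG.sum_covCurv hz he, ← hG.sum_covCurv hz he,
    ← Finset.sum_sub_distrib, ← Finset.sum_add_distrib]
  refine Finset.sum_eq_zero fun i _ ↦ ?_
  have h1 := congr($(congrArg (G z) (hG.covCurv_bianchi hz u (e i) v w)) (e i))
  rw [hG.covCurv_swap hz v u] at h1
  simpa [sub_eq_add_neg, add_right_comm] using h1

/-- The second Bianchi identity, contracted twice. -/
lemma contracted_bianchi (u : E) :
    β z u * traceCLM E (ricOp G z) = 2 * β z (ricOp G z u) := by
  have hG := h.toIsMetricOn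
  obtain ⟨e, he⟩ := hG.exists_isOrthonormalAt hz
  have h1 : ∑ j, β z (e j) * ric G z u (e j) = β z (ricOp G z u) := by
    conv_rhs => rw [← he.sum_apply_smul (ricOp G z u)]
    simp [hG.apply_ricOp hz, mul_comm]
  -- Skewness of ∇R in its last two slots turns the sum over j into −(∇Ric)(u, eᵢ) in the direction
  -- eᵢ, which recurrence evaluates as −β(eᵢ) Ric(u, eᵢ).
  have h2 : ∑ j, ∑ i, G z (covCurv G z (e i) (e j) u (e j)) (e i) = - β z (ricOp G z u) := by
    rw [Finset.sum_comm, ← h1, ← Finset.sum_neg_distrib]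
    refine Finset.sum_congr rfl fun i _ ↦ ?_
    rw [← h.recurrent z hz, ← hG.sum_covCurv hz he, ← Finset.sum_neg_distrib]
    refine Finset.sum_congr rfl fun j _ ↦ ?_
    rw [hG.covCurv_skew hz, hG.symm z hz]
  have h3 := Finset.sum_congr rfl fun j (_ : j ∈ Finset.univ) ↦
    h.sum_covCurv_add hz he u (e j) (e j)
  rw [Finset.sum_add_distrib, Finset.sum_sub_distrib, h1, h2, ← Finset.mul_sum] at h3
  simp only [he.traceCLM_eq, hG.apply_ricOp hz]
  simp only [Finset.sum_const_zero] at h3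
  linarith

/-- The vector dual to the recurrence form is an eigenvector of the Ricci endomorphism. -/
lemma ricOp_sharp {b : E} (hb : ∀ c, G z b c = β z c) :
    ricOp G z b = (traceCLM E (ricOp G z) / 2) • b := by
  have hG := h.toIsMetricOn
  refine hG.eq_of_forall hz fun c ↦ ?_
  rw [hG.ricOp_symm hz, hb, map_smul, smul_apply, hb, smul_eq_mul]
  linarith [h.contracted_bianchi hz c]

/-- Where the recurrence form does not vanish, the Ricci endomorphism `A` satisfies
`A ∘ A = (tr A / 2) • A`. -/
lemma ricOp_comp_self (hβ : β z ≠ 0) :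
    ricOp G z ∘L ricOp G z = (traceCLM E (ricOp G z) / 2) • ricOp G z := by
  have hG := h.toIsMetricOn
  rcases eq_or_ne (ricOp G z) 0 with hA | hA
  · simp [hA]
  obtain ⟨e, he⟩ := hG.exists_isOrthonormalAt hz
  obtain ⟨b, hb⟩ : ∃ b, ∀ c, G z b c = β z c := ⟨_, hG.apply_inverse hz (β z)⟩
  have hAb := h.ricOp_sharp hz hb
  set s := traceCLM E (ricOp G z) / 2
  have hb0 : b ≠ 0 := by
    rintro rfl
    exact hβ (by ext c; simp [← hb c])
  have hβb : β z b ≠ 0 := by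
    rw [← hb]
    exact (hG.pos z hz b hb0).ne'
  ext v
  -- Since b is an s-eigenvector of the symmetric A, the image of A − s is orthogonal to b.
  have hβv : β z (ricOp G z v - s • v) = 0 := by
    rw [← hb, map_sub, ← hG.ricOp_symm hz, hAb]
    simp
  -- `covCurv_ricOp` moves A from v to b, where it acts as s.
  have hcov (u c : E) : covCurv G z u (ricOp G z v - s • v) b c = 0 := by
    have h1 := h.covCurv_ricOp hz hA u v b c
    rw [hAb] at h1
    simp only [covCurv, map_sub, map_smul, sub_apply, smul_apply] at h1 ⊢
    rw [← sub_eq_zero] at h1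
    rw [← h1]
    module
  -- In the once contracted Bianchi identity for b and (A − s)v only β(b) Ric((A − s)v, w) survives,
  -- and β(b) = |b|² ≠ 0.
  have h0 : ricOp G z (ricOp G z v - s • v) = 0 := by
    refine hG.eq_of_forall hz fun w ↦ ?_
    have h1 := h.sum_covCurv_add hz he b (ricOp G z v - s • v) w
    rw [hβv] at h1
    simp only [hcov, map_zero, zero_apply, Finset.sum_const_zero, zero_mul, sub_zero, add_zero,
      mul_eq_zero, hβb, false_or] at h1
    rw [hG.apply_ricOp hz, h1]
    simp
  rw [map_sub, map_smul, sub_eq_zero] at h0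
  exact h0

end IsRecurrentOn

end

/-! ### Vector fields, brackets and the metric in a chart -/

noncomputable section

section Chart

variable {n : ℕ} {M : Type*} [TopologicalSpace M] [ChartedSpace (EuclideanSpace ℝ (Fin n)) M]
  [IsManifold (𝓡 n) ∞ M] [RiemannianBundle (fun x : M ↦ TangentSpace (𝓡 n) x)]

/-- The components of a tangent vector at `y` in the chart at `x₀`. -/
def chartCoord (x₀ y : M) : TangentSpace (𝓡 n) y →L[ℝ] EuclideanSpace ℝ (Fin n) :=
  (trivializationAt (EuclideanSpace ℝ (Fin n)) (TangentSpace (𝓡 n)) x₀).continuousLinearMapAt ℝ y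

/-- The tangent vector at `y` with given components in the chart at `x₀`. -/
def chartVec (x₀ y : M) : EuclideanSpace ℝ (Fin n) →L[ℝ] TangentSpace (𝓡 n) y :=
  (trivializationAt (EuclideanSpace ℝ (Fin n)) (TangentSpace (𝓡 n)) x₀).symmL ℝ y

/-- The components of a vector field in the chart at `x₀`. -/
def chartField (x₀ : M) (X : (y : M) → TangentSpace (𝓡 n) y) (z : EuclideanSpace ℝ (Fin n)) :
    EuclideanSpace ℝ (Fin n) :=
  chartCoord x₀ ((extChartAt (𝓡 n) x₀).symm z) (X ((extChartAt (𝓡 n) x₀).symm z))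

/-- The Riemannian metric in the chart at `x₀`. -/
def chartMetric (x₀ : M) (z : EuclideanSpace ℝ (Fin n)) :
    EuclideanSpace ℝ (Fin n) →L[ℝ] EuclideanSpace ℝ (Fin n) →L[ℝ] ℝ :=
  LinearMap.toContinuousLinearMap
    ((LinearMap.toContinuousLinearMap (𝕜 := ℝ) (E := EuclideanSpace ℝ (Fin n))
      (F' := ℝ)).toLinearMap ∘ₗ LinearMap.mk₂ ℝ (fun a b ↦ inner ℝ (chartVec x₀ ((extChartAt (𝓡 n) x₀).symm z) a)
        (chartVec x₀ ((extChartAt (𝓡 n) x₀).symm z) b))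
        (fun _ _ _ ↦ by rw [map_add, inner_add_left])
        (fun _ _ _ ↦ by rw [map_smul, real_inner_smul_left]; rfl)
        (fun _ _ _ ↦ by rw [map_add, inner_add_right])
        (fun _ _ _ ↦ by rw [map_smul, real_inner_smul_right]; rfl))

variable {x₀ y : M}

lemma chartMetric_apply (z a b : EuclideanSpace ℝ (Fin n)) : chartMetric x₀ z a b =
    inner ℝ (chartVec x₀ ((extChartAt (𝓡 n) x₀).symm z) a)
      (chartVec x₀ ((extChartAt (𝓡 n) x₀).symm z) b) := rfl

lemma chartCoord_chartVec (hy : y ∈ (extChartAt (𝓡 n) x₀).source)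
    (a : EuclideanSpace ℝ (Fin n)) : chartCoord x₀ y (chartVec x₀ y a) = a :=
  (trivializationAt (EuclideanSpace ℝ (Fin n)) (TangentSpace (𝓡 n)) x₀
    ).continuousLinearMapAt_symmL (by simpa using hy) a

lemma chartVec_chartCoord (hy : y ∈ (extChartAt (𝓡 n) x₀).source) (v : TangentSpace (𝓡 n) y) :
    chartVec x₀ y (chartCoord x₀ y v) = v :=
  (trivializationAt (EuclideanSpace ℝ (Fin n)) (TangentSpace (𝓡 n)) x₀
    ).symmL_continuousLinearMapAt (by simpa using hy) v

lemma chartField_apply (hy : y ∈ (extChartAt (𝓡 n) x₀).source)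
    (X : (y : M) → TangentSpace (𝓡 n) y) :
    chartField x₀ X (extChartAt (𝓡 n) x₀ y) = chartCoord x₀ y (X y) := by
  rw [chartField, (extChartAt (𝓡 n) x₀).left_inv hy]

lemma chartMetric_chartCoord (hy : y ∈ (extChartAt (𝓡 n) x₀).source)
    (v w : TangentSpace (𝓡 n) y) : chartMetric x₀ (extChartAt (𝓡 n) x₀ y) (chartCoord x₀ y v)
      (chartCoord x₀ y w) = inner ℝ v w := by
  rw [chartMetric_apply, (extChartAt (𝓡 n) x₀).left_inv hy, chartVec_chartCoord hy,
    chartVec_chartCoord hy]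

/-- The linear isomorphism given by the chart at `x₀` on the tangent space at `y`. -/
def chartEquiv (hy : y ∈ (extChartAt (𝓡 n) x₀).source) :
    TangentSpace (𝓡 n) y ≃ₗ[ℝ] EuclideanSpace ℝ (Fin n) :=
  LinearEquiv.ofLinearMap (chartCoord x₀ y).toLinearMap (chartVec x₀ y).toLinearMap
    (LinearMap.ext fun a ↦ chartCoord_chartVec hy a)
    (LinearMap.ext fun v ↦ chartVec_chartCoord hy v)

lemma contMDiffAt_iff_chart {F : Type*} [NormedAddCommGroup F] [NormedSpace ℝ F] {f : M → F}
    (hy : y ∈ (extChartAt (𝓡 n) x₀).source) :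
    ContMDiffAt (𝓡 n) 𝓘(ℝ, F) ∞ f y ↔
      ContDiffAt ℝ ∞ (f ∘ (extChartAt (𝓡 n) x₀).symm) (extChartAt (𝓡 n) x₀ y) := by
  rw [contMDiffAt_iff_source_of_mem_source (by simpa using hy), ModelWithCorners.range_eq_univ,
    contMDiffWithinAt_univ, contMDiffAt_iff_contDiffAt]

lemma mdifferentiableAt_iff_chart {F : Type*} [NormedAddCommGroup F] [NormedSpace ℝ F] {f : M → F}
    (hy : y ∈ (extChartAt (𝓡 n) x₀).source) :
    MDifferentiableAt (𝓡 n) 𝓘(ℝ, F) f y ↔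
      DifferentiableAt ℝ (f ∘ (extChartAt (𝓡 n) x₀).symm) (extChartAt (𝓡 n) x₀ y) := by
  rw [mdifferentiableAt_iff_source_of_mem_source (by simpa using hy),
    ModelWithCorners.range_eq_univ, mdifferentiableWithinAt_univ,
    mdifferentiableAt_iff_differentiableAt]

lemma mfderiv_extChartAt_eq (hy : y ∈ (extChartAt (𝓡 n) x₀).source) :
    mfderiv (𝓡 n) 𝓘(ℝ, EuclideanSpace ℝ (Fin n)) (extChartAt (𝓡 n) x₀) y = chartCoord x₀ y :=
  (TangentBundle.continuousLinearMapAt_trivializationAt (by simpa using hy)).symm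

/-- The differential of a function in terms of the chart at `x₀`. -/
lemma mvfderiv_eq_chart {f : M → ℝ} (hy : y ∈ (extChartAt (𝓡 n) x₀).source)
    (hf : MDifferentiableAt (𝓡 n) 𝓘(ℝ, ℝ) f y) (v : TangentSpace (𝓡 n) y) :
    mvfderiv (𝓡 n) f y v = fderiv ℝ (f ∘ (extChartAt (𝓡 n) x₀).symm) (extChartAt (𝓡 n) x₀ y)
      (chartCoord x₀ y v) := by
  have hfψ := (mdifferentiableAt_iff_chart hy).1 hf
  have hφ : MDifferentiableAt (𝓡 n) 𝓘(ℝ, EuclideanSpace ℝ (Fin n)) (extChartAt (𝓡 n) x₀) y :=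
    mdifferentiableAt_extChartAt (by simpa using hy)
  have hev : f =ᶠ[𝓝 y] (f ∘ (extChartAt (𝓡 n) x₀).symm) ∘ extChartAt (𝓡 n) x₀ := by
    filter_upwards [(isOpen_extChartAt_source x₀).mem_nhds hy] with w hw
    rw [Function.comp_apply, Function.comp_apply, (extChartAt (𝓡 n) x₀).left_inv hw]
  rw [mvfderiv, hev.mfderiv_eq, mfderiv_comp y hfψ.mdifferentiableAt hφ, mfderiv_eq_fderiv,
    mfderiv_extChartAt_eq hy]
  rfl

lemma trivializationAt_eventuallyEq_chartCoord (X : (y : M) → TangentSpace (𝓡 n) y)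
    (hy : y ∈ (extChartAt (𝓡 n) x₀).source) :
    (fun w ↦ (trivializationAt (EuclideanSpace ℝ (Fin n)) (TangentSpace (𝓡 n)) x₀ ⟨w, X w⟩).2)
      =ᶠ[𝓝 y] fun w ↦ chartCoord x₀ w (X w) := by
  filter_upwards [(isOpen_extChartAt_source x₀).mem_nhds hy] with w hw
  rw [chartCoord, Trivialization.continuousLinearMapAt_apply,
    Trivialization.coe_linearMapAt_of_mem _ (by simpa using hw)]

lemma contMDiffAt_field_iff {X : (y : M) → TangentSpace (𝓡 n) y}
    (hy : y ∈ (extChartAt (𝓡 n) x₀).source) :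
    ContMDiffAt (𝓡 n) (𝓡 n).tangent ∞ (fun y ↦ (⟨y, X y⟩ : TangentBundle (𝓡 n) M)) y ↔
      ContDiffAt ℝ ∞ (chartField x₀ X) (extChartAt (𝓡 n) x₀ y) := by
  refine ((trivializationAt (EuclideanSpace ℝ (Fin n)) (TangentSpace (𝓡 n)) x₀
    ).contMDiffAt_section_iff (by simpa using hy)).trans ?_
  rw [(trivializationAt_eventuallyEq_chartCoord X hy).contMDiffAt_iff, contMDiffAt_iff_chart hy]
  rfl

lemma mdifferentiableAt_field_iff {X : (y : M) → TangentSpace (𝓡 n) y}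
    (hy : y ∈ (extChartAt (𝓡 n) x₀).source) :
    MDifferentiableAt (𝓡 n) (𝓡 n).tangent (fun y ↦ (⟨y, X y⟩ : TangentBundle (𝓡 n) M)) y ↔
      DifferentiableAt ℝ (chartField x₀ X) (extChartAt (𝓡 n) x₀ y) := by
  refine ((trivializationAt (EuclideanSpace ℝ (Fin n)) (TangentSpace (𝓡 n)) x₀
    ).mdifferentiableAt_section_iff (𝓡 n) X (by simpa using hy)).trans ?_
  rw [(trivializationAt_eventuallyEq_chartCoord X hy).mdifferentiableAt_iff,
    mdifferentiableAt_iff_chart hy]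
  rfl

lemma isInvertible_chartCoord (hy : y ∈ (extChartAt (𝓡 n) x₀).source) :
    (chartCoord (n := n) x₀ y).IsInvertible :=
  .of_inverse (g := chartVec x₀ y) (by ext1 a; exact chartCoord_chartVec hy a)
    (by ext1 v; exact chartVec_chartCoord hy v)

/-- Presents the field as a pullback, so that naturality of the Lie bracket under pullback applies.
-/
lemma mpullback_chartField (X : (y : M) → TangentSpace (𝓡 n) y)
    (hy : y ∈ (extChartAt (𝓡 n) x₀).source) :
    VectorField.mpullback (𝓡 n) 𝓘(ℝ, EuclideanSpace ℝ (Fin n)) (extChartAt (𝓡 n) x₀)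
      (chartField x₀ X) y = X y := by
  have h := (isInvertible_chartCoord hy).inverse_apply_eq.2 (chartField_apply hy X)
  rw [← mfderiv_extChartAt_eq hy] at h
  exact h

lemma mlieBracket_eq_lieBracket {E : Type*} [NormedAddCommGroup E] [NormedSpace ℝ E]
    (X Y : (z : E) → TangentSpace 𝓘(ℝ, E) z) :
    VectorField.mlieBracket 𝓘(ℝ, E) X Y = VectorField.lieBracket ℝ X Y := by
  rw [← VectorField.mlieBracketWithin_univ, VectorField.mlieBracketWithin_eq_lieBracketWithin]
  exact VectorField.lieBracketWithin_univ

/-- The Lie bracket in the chart at `x₀`. -/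
lemma chartCoord_mlieBracket {X Y : (y : M) → TangentSpace (𝓡 n) y}
    (hy : y ∈ (extChartAt (𝓡 n) x₀).source)
    (hX : DifferentiableAt ℝ (chartField x₀ X) (extChartAt (𝓡 n) x₀ y))
    (hY : DifferentiableAt ℝ (chartField x₀ Y) (extChartAt (𝓡 n) x₀ y)) :
    chartCoord x₀ y (VectorField.mlieBracket (𝓡 n) X Y y) =
      fderiv ℝ (chartField x₀ Y) (extChartAt (𝓡 n) x₀ y) (chartCoord x₀ y (X y))
      - fderiv ℝ (chartField x₀ X) (extChartAt (𝓡 n) x₀ y) (chartCoord x₀ y (Y y)) := by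
  have h2 : minSmoothness ℝ 2 ≤ ∞ := by
    simpa using (WithTop.coe_le_coe.2 le_top : ((2 : ℕ∞) : WithTop ℕ∞) ≤ ∞)
  have : IsManifold (𝓡 n) (minSmoothness ℝ 2) M := .of_le h2
  have hev (X : (y : M) → TangentSpace (𝓡 n) y) :
      VectorField.mpullback (𝓡 n) 𝓘(ℝ, EuclideanSpace ℝ (Fin n)) (extChartAt (𝓡 n) x₀)
        (chartField x₀ X) =ᶠ[𝓝 y] X := by
    filter_upwards [(isOpen_extChartAt_source x₀).mem_nhds hy] with w hw
    exact mpullback_chartField X hw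
  have hd {X : EuclideanSpace ℝ (Fin n) → EuclideanSpace ℝ (Fin n)} {z}
      (h : DifferentiableAt ℝ X z) :
      MDifferentiableAt 𝓘(ℝ, EuclideanSpace ℝ (Fin n)) 𝓘(ℝ, EuclideanSpace ℝ (Fin n)).tangent
        (fun z ↦ (⟨z, X z⟩ : TangentBundle 𝓘(ℝ, EuclideanSpace ℝ (Fin n)) _)) z := by
    refine (mdifferentiableAt_section _ _).2 ?_
    simpa using h.mdifferentiableAt
  have h1 := VectorField.mpullback_mlieBracket (𝕜 := ℝ) (I := 𝓡 n)
    (I' := 𝓘(ℝ, EuclideanSpace ℝ (Fin n))) (f := extChartAt (𝓡 n) x₀) (x₀ := y) (n := ∞)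
    (V := chartField x₀ X) (W := chartField x₀ Y) (hd hX) (hd hY)
    (contMDiffAt_extChartAt' (by simpa using hy)) h2
  rw [(hev X).mlieBracket_vectorField_eq (hev Y), VectorField.mpullback_apply,
    mfderiv_extChartAt_eq hy] at h1
  rw [← h1]
  refine ((isInvertible_chartCoord hy).self_apply_inverse _).trans ?_
  refine (congrFun (mlieBracket_eq_lieBracket (chartField x₀ X) (chartField x₀ Y)) _).trans ?_
  rw [VectorField.lieBracket, chartField_apply hy, chartField_apply hy]

lemma extendVector_self (v : TangentSpace (𝓡 n) y) : extendVector v y = v :=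
  FiberBundle.extend_apply_self _ v

lemma contMDiffAt_extendVector {w : M} (v : TangentSpace (𝓡 n) y)
    (hw : w ∈ (extChartAt (𝓡 n) y).source) :
    ContMDiffAt (𝓡 n) (𝓡 n).tangent ∞
      (fun y ↦ (⟨y, extendVector v y⟩ : TangentBundle (𝓡 n) M)) w := by
  refine ((trivializationAt (EuclideanSpace ℝ (Fin n)) (TangentSpace (𝓡 n)) y
    ).contMDiffAt_section_iff (by simpa using hw)).2 ?_
  refine (contMDiffAt_const (c := (trivializationAt (EuclideanSpace ℝ (Fin n))
    (TangentSpace (𝓡 n)) y ⟨y, v⟩).2)).congr_of_eventuallyEq ?_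
  filter_upwards [(isOpen_extChartAt_source y).mem_nhds hw] with u hu
  rw [extendVector, FiberBundle.extend, Trivialization.apply_mk_symm _ (by simpa using hu)]

/-- A vector field whose components in the chart at `x₀` are smooth near `z`. -/
def SmoothNear (x₀ : M) (X : (y : M) → TangentSpace (𝓡 n) y) (z : EuclideanSpace ℝ (Fin n)) :
    Prop :=
  ∀ᶠ z' in 𝓝 z, ContDiffAt ℝ ∞ (chartField x₀ X) z'

/-- The extension is constant in the chart at y but is read in the chart at x₀, so smoothness is
claimed only near y, where both charts are defined. -/
lemma smoothNear_extendVector (v : TangentSpace (𝓡 n) y)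
    (hy : y ∈ (extChartAt (𝓡 n) x₀).source) :
    SmoothNear x₀ (extendVector v) (extChartAt (𝓡 n) x₀ y) := by
  have hcont : ContinuousAt (extChartAt (𝓡 n) x₀).symm (extChartAt (𝓡 n) x₀ y) :=
    continuousAt_extChartAt_symm' hy
  have hs : (extChartAt (𝓡 n) y).source ∈
      𝓝 ((extChartAt (𝓡 n) x₀).symm (extChartAt (𝓡 n) x₀ y)) := by
    rw [(extChartAt (𝓡 n) x₀).left_inv hy]
    exact extChartAt_source_mem_nhds y
  filter_upwards [(isOpen_extChartAt_target x₀).mem_nhds ((extChartAt (𝓡 n) x₀).map_source hy),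
    hcont hs] with z' hz' hz'y
  have h := (contMDiffAt_field_iff ((extChartAt (𝓡 n) x₀).map_target hz')).1
    (contMDiffAt_extendVector v hz'y)
  rwa [(extChartAt (𝓡 n) x₀).right_inv hz'] at h

lemma contMDiffAt_chartVec (a : EuclideanSpace ℝ (Fin n))
    (hy : y ∈ (extChartAt (𝓡 n) x₀).source) :
    ContMDiffAt (𝓡 n) (𝓡 n).tangent ∞
      (fun y ↦ (⟨y, chartVec x₀ y a⟩ : TangentBundle (𝓡 n) M)) y := by
  rw [contMDiffAt_field_iff hy]
  refine (contDiffAt_const (c := a)).congr_of_eventuallyEq ?_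
  filter_upwards [(isOpen_extChartAt_target x₀).mem_nhds ((extChartAt (𝓡 n) x₀).map_source hy)]
    with z hz
  exact chartCoord_chartVec ((extChartAt (𝓡 n) x₀).map_target hz) a

variable [IsContMDiffRiemannianBundle (𝓡 n) ∞ (EuclideanSpace ℝ (Fin n))
      (fun x : M ↦ TangentSpace (𝓡 n) x)]

lemma isMetricOn_chartMetric (x₀ : M) :
    IsMetricOn (chartMetric x₀) (extChartAt (𝓡 n) x₀).target where
  isOpen := isOpen_extChartAt_target x₀
  contDiffOn := by
    refine contDiffOn_clm_apply.2 fun a ↦ contDiffOn_clm_apply.2 fun b z hz ↦ ?_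
    have hy := (extChartAt (𝓡 n) x₀).map_target hz
    have h := (contMDiffAt_iff_chart hy).1
      ((contMDiffAt_chartVec a hy).inner_bundle (contMDiffAt_chartVec b hy))
    rw [(extChartAt (𝓡 n) x₀).right_inv hz] at h
    exact h.contDiffWithinAt
  symm z _ a b := by rw [chartMetric_apply, chartMetric_apply, real_inner_comm]
  pos z hz a ha := by
    rw [chartMetric_apply, real_inner_self_pos]
    intro h
    have := chartCoord_chartVec ((extChartAt (𝓡 n) x₀).map_target hz) a
    rw [h, map_zero] at this
    exact ha this.symm

end Chart
end

/-! ### Levi-Civita connection, curvature and Ricci tensor in a chart -/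

noncomputable section

section Chart

variable {n : ℕ} {M : Type*} [TopologicalSpace M] [ChartedSpace (EuclideanSpace ℝ (Fin n)) M]
  [IsManifold (𝓡 n) ∞ M] [RiemannianBundle (fun x : M ↦ TangentSpace (𝓡 n) x)]
  [IsContMDiffRiemannianBundle (𝓡 n) ∞ (EuclideanSpace ℝ (Fin n))
    (fun x : M ↦ TangentSpace (𝓡 n) x)]
  {x₀ y : M}

open ChartMetric

lemma mdifferentiableAt_inner {Y Z : (y : M) → TangentSpace (𝓡 n) y}
    (hy : y ∈ (extChartAt (𝓡 n) x₀).source)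
    (hY : DifferentiableAt ℝ (chartField x₀ Y) (extChartAt (𝓡 n) x₀ y))
    (hZ : DifferentiableAt ℝ (chartField x₀ Z) (extChartAt (𝓡 n) x₀ y)) :
    MDifferentiableAt (𝓡 n) 𝓘(ℝ, ℝ) (fun y ↦ inner ℝ (Y y) (Z y)) y :=
  have : IsContMDiffRiemannianBundle (𝓡 n) 1 (EuclideanSpace ℝ (Fin n))
      (fun x : M ↦ TangentSpace (𝓡 n) x) := .of_le (n := ∞) (by simp)
  ((mdifferentiableAt_field_iff hy).2 hY).inner_bundle ((mdifferentiableAt_field_iff hy).2 hZ)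

lemma mvfderiv_inner {Y Z : (y : M) → TangentSpace (𝓡 n) y}
    (hy : y ∈ (extChartAt (𝓡 n) x₀).source)
    (hY : DifferentiableAt ℝ (chartField x₀ Y) (extChartAt (𝓡 n) x₀ y))
    (hZ : DifferentiableAt ℝ (chartField x₀ Z) (extChartAt (𝓡 n) x₀ y))
    (v : TangentSpace (𝓡 n) y) :
    mvfderiv (𝓡 n) (fun y ↦ inner ℝ (Y y) (Z y)) y v =
      fderiv ℝ (chartMetric x₀) (extChartAt (𝓡 n) x₀ y) (chartCoord x₀ y v)
          (chartCoord x₀ y (Y y)) (chartCoord x₀ y (Z y))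
      + chartMetric x₀ (extChartAt (𝓡 n) x₀ y) (fderiv ℝ (chartField x₀ Y)
          (extChartAt (𝓡 n) x₀ y) (chartCoord x₀ y v)) (chartCoord x₀ y (Z y))
      + chartMetric x₀ (extChartAt (𝓡 n) x₀ y) (chartCoord x₀ y (Y y)) (fderiv ℝ (chartField x₀ Z)
          (extChartAt (𝓡 n) x₀ y) (chartCoord x₀ y v)) := by
  have hG := isMetricOn_chartMetric (n := n) x₀
  have hz := (extChartAt (𝓡 n) x₀).map_source hy
  have hi := mdifferentiableAt_inner hy hY hZ
  rw [mvfderiv_eq_chart hy hi]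
  have h1 := ((mdifferentiableAt_iff_chart hy).1 hi).hasLineDerivAt_fderiv (chartCoord x₀ y v)
  have h2 := ((hG.hasLineDerivAt hz (chartCoord x₀ y v)).clm_apply
    (hY.hasLineDerivAt_fderiv _)).clm_apply (hZ.hasLineDerivAt_fderiv _)
  rw [HasLineDerivAt.unique_of_eqOn hG.isOpen hz h1 h2, chartField_apply hy, chartField_apply hy,
    add_apply]
  intro z hz
  have hw := (extChartAt (𝓡 n) x₀).map_target hz
  simp only [Function.comp_apply]
  rw [← chartMetric_chartCoord hw, (extChartAt (𝓡 n) x₀).right_inv hz]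
  rfl

/-- The derivatives of Z cancel, so the Koszul expression depends on Z only through its value at y.
Hence the pointwise choice of frame in `leviCivita` and the way it is extended are immaterial. -/
lemma koszul_eq {X Y Z : (y : M) → TangentSpace (𝓡 n) y}
    (hy : y ∈ (extChartAt (𝓡 n) x₀).source)
    (hX : DifferentiableAt ℝ (chartField x₀ X) (extChartAt (𝓡 n) x₀ y))
    (hY : DifferentiableAt ℝ (chartField x₀ Y) (extChartAt (𝓡 n) x₀ y))
    (hZ : DifferentiableAt ℝ (chartField x₀ Z) (extChartAt (𝓡 n) x₀ y)) :
    koszul X Y Z y = 2 * chartMetric x₀ (extChartAt (𝓡 n) x₀ y)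
      (fderiv ℝ (chartField x₀ Y) (extChartAt (𝓡 n) x₀ y) (chartCoord x₀ y (X y))
        + christoffel (chartMetric x₀) (extChartAt (𝓡 n) x₀ y) (chartCoord x₀ y (X y))
          (chartCoord x₀ y (Y y))) (chartCoord x₀ y (Z y)) := by
  have hG := isMetricOn_chartMetric (n := n) x₀
  have hz := (extChartAt (𝓡 n) x₀).map_source hy
  rw [koszul, mvfderiv_inner hy hY hZ, mvfderiv_inner hy hX hZ, mvfderiv_inner hy hX hY,
    ← chartMetric_chartCoord hy, ← chartMetric_chartCoord hy, ← chartMetric_chartCoord hy,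
    chartCoord_mlieBracket hy hX hY, chartCoord_mlieBracket hy hX hZ,
    chartCoord_mlieBracket hy hY hZ]
  have hs := hG.symm _ hz
  have hc := hG.christoffel_symm hz
  simp only [hG.fderiv_apply hz, map_add, map_sub, add_apply, sub_apply]
  generalize chartCoord x₀ y (X y) = a
  generalize chartCoord x₀ y (Y y) = b
  generalize chartCoord x₀ y (Z y) = c
  rw [hc b a, hc c a, hc c b, hs b, hs a, hs a (fderiv ℝ (chartField x₀ Z) _ b),
    hs a (fderiv ℝ (chartField x₀ Y) _ c), hs b (fderiv ℝ (chartField x₀ Z) _ a)]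
  ring

lemma sum_inner_tangentFrame (v : TangentSpace (𝓡 n) y) :
    ∑ i, inner ℝ v (tangentFrame n y i) • tangentFrame n y i = v := by
  conv_rhs => rw [← (tangentFrame n y).sum_repr' v]
  exact Finset.sum_congr rfl fun i _ ↦ by rw [real_inner_comm]

lemma SmoothNear.contDiffAt {X : (y : M) → TangentSpace (𝓡 n) y}
    {z : EuclideanSpace ℝ (Fin n)} (hX : SmoothNear x₀ X z) :
    ContDiffAt ℝ ∞ (chartField x₀ X) z :=
  hX.self_of_nhds

lemma SmoothNear.differentiableAt {X : (y : M) → TangentSpace (𝓡 n) y}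
    {z : EuclideanSpace ℝ (Fin n)} (hX : SmoothNear x₀ X z) :
    DifferentiableAt ℝ (chartField x₀ X) z :=
  hX.contDiffAt.differentiableAt (by simp)

/-- The Levi-Civita covariant derivative in the chart at `x₀`. -/
lemma chartCoord_leviCivita {X Y : (y : M) → TangentSpace (𝓡 n) y}
    (hy : y ∈ (extChartAt (𝓡 n) x₀).source)
    (hX : DifferentiableAt ℝ (chartField x₀ X) (extChartAt (𝓡 n) x₀ y))
    (hY : DifferentiableAt ℝ (chartField x₀ Y) (extChartAt (𝓡 n) x₀ y)) :
    chartCoord x₀ y (leviCivita X Y y) =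
      fderiv ℝ (chartField x₀ Y) (extChartAt (𝓡 n) x₀ y) (chartCoord x₀ y (X y))
        + christoffel (chartMetric x₀) (extChartAt (𝓡 n) x₀ y) (chartCoord x₀ y (X y))
          (chartCoord x₀ y (Y y)) := by
  set w := fderiv ℝ (chartField x₀ Y) (extChartAt (𝓡 n) x₀ y) (chartCoord x₀ y (X y))
    + christoffel (chartMetric x₀) (extChartAt (𝓡 n) x₀ y) (chartCoord x₀ y (X y))
      (chartCoord x₀ y (Y y)) with hw
  suffices h : leviCivita X Y y = chartVec x₀ y w by rw [h, chartCoord_chartVec hy]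
  rw [← sum_inner_tangentFrame (chartVec x₀ y w)]
  refine Finset.sum_congr rfl fun i _ ↦ ?_
  rw [koszul_eq hy hX hY (smoothNear_extendVector _ hy).differentiableAt, extendVector_self, ← hw,
    ← chartMetric_chartCoord hy, chartCoord_chartVec hy]
  congr 1
  ring

lemma chartField_leviCivita {X Y : (y : M) → TangentSpace (𝓡 n) y}
    {z : EuclideanSpace ℝ (Fin n)} (hz : z ∈ (extChartAt (𝓡 n) x₀).target)
    (hX : SmoothNear x₀ X z) (hY : SmoothNear x₀ Y z) :
    chartField x₀ (leviCivita X Y) =ᶠ[𝓝 z] fun z ↦ fderiv ℝ (chartField x₀ Y) z (chartField x₀ X z)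
      + christoffel (chartMetric x₀) z (chartField x₀ X z) (chartField x₀ Y z) := by
  filter_upwards [hX, hY, (isOpen_extChartAt_target x₀).mem_nhds hz] with z' hX' hY' hz'
  have h := chartCoord_leviCivita ((extChartAt (𝓡 n) x₀).map_target hz') (X := X) (Y := Y)
    (by rw [(extChartAt (𝓡 n) x₀).right_inv hz']; exact hX'.differentiableAt (by simp))
    (by rw [(extChartAt (𝓡 n) x₀).right_inv hz']; exact hY'.differentiableAt (by simp))
  rw [(extChartAt (𝓡 n) x₀).right_inv hz'] at h
  exact h

lemma smoothNear_leviCivita {X Y : (y : M) → TangentSpace (𝓡 n) y}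
    {z : EuclideanSpace ℝ (Fin n)} (hz : z ∈ (extChartAt (𝓡 n) x₀).target)
    (hX : SmoothNear x₀ X z) (hY : SmoothNear x₀ Y z) :
    SmoothNear x₀ (leviCivita X Y) z := by
  have hG := isMetricOn_chartMetric (n := n) x₀
  filter_upwards [(chartField_leviCivita hz hX hY).eventuallyEq_nhds, hX, hY,
    (isOpen_extChartAt_target x₀).mem_nhds hz] with z' he hX' hY' hz'
  refine ContDiffAt.congr_of_eventuallyEq ?_ he
  have hΓ := hG.contDiffOn_christoffel.contDiffAt (hG.isOpen.mem_nhds hz')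
  have hD : ContDiffAt ℝ ∞ (fderiv ℝ (chartField x₀ Y)) z' := hY'.fderiv_right (by simp)
  exact (hD.clm_apply hX').add ((hΓ.clm_apply hX').clm_apply hY')

lemma chartField_mlieBracket {X Y : (y : M) → TangentSpace (𝓡 n) y}
    {z : EuclideanSpace ℝ (Fin n)} (hz : z ∈ (extChartAt (𝓡 n) x₀).target)
    (hX : SmoothNear x₀ X z) (hY : SmoothNear x₀ Y z) :
    chartField x₀ (VectorField.mlieBracket (𝓡 n) X Y) =ᶠ[𝓝 z]
      fun z ↦ fderiv ℝ (chartField x₀ Y) z (chartField x₀ X z)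
        - fderiv ℝ (chartField x₀ X) z (chartField x₀ Y z) := by
  filter_upwards [hX, hY, (isOpen_extChartAt_target x₀).mem_nhds hz] with z' hX' hY' hz'
  have h := chartCoord_mlieBracket ((extChartAt (𝓡 n) x₀).map_target hz') (X := X) (Y := Y)
    (by rw [(extChartAt (𝓡 n) x₀).right_inv hz']; exact hX'.differentiableAt (by simp))
    (by rw [(extChartAt (𝓡 n) x₀).right_inv hz']; exact hY'.differentiableAt (by simp))
  rw [(extChartAt (𝓡 n) x₀).right_inv hz'] at h
  exact h

lemma differentiableAt_chartField_mlieBracket {X Y : (y : M) → TangentSpace (𝓡 n) y}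
    {z : EuclideanSpace ℝ (Fin n)} (hz : z ∈ (extChartAt (𝓡 n) x₀).target)
    (hX : SmoothNear x₀ X z) (hY : SmoothNear x₀ Y z) :
    DifferentiableAt ℝ (chartField x₀ (VectorField.mlieBracket (𝓡 n) X Y)) z := by
  refine DifferentiableAt.congr_of_eventuallyEq ?_ (chartField_mlieBracket hz hX hY)
  have hDX : ContDiffAt ℝ ∞ (fderiv ℝ (chartField x₀ X)) z := hX.contDiffAt.fderiv_right (by simp)
  have hDY : ContDiffAt ℝ ∞ (fderiv ℝ (chartField x₀ Y)) z := hY.contDiffAt.fderiv_right (by simp)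
  exact ((hDY.clm_apply hX.contDiffAt).sub (hDX.clm_apply hY.contDiffAt)).differentiableAt (by simp)

/-- Iterated covariant derivatives in the chart at `x₀`. -/
lemma chartCoord_leviCivita_leviCivita {X Y Z : (y : M) → TangentSpace (𝓡 n) y}
    (hy : y ∈ (extChartAt (𝓡 n) x₀).source)
    (hX : SmoothNear x₀ X (extChartAt (𝓡 n) x₀ y)) (hY : SmoothNear x₀ Y (extChartAt (𝓡 n) x₀ y))
    (hZ : SmoothNear x₀ Z (extChartAt (𝓡 n) x₀ y)) :
    let z := extChartAt (𝓡 n) x₀ y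
    let a := chartCoord x₀ y (X y)
    let b := chartCoord x₀ y (Y y)
    let c := chartCoord x₀ y (Z y)
    chartCoord x₀ y (leviCivita X (leviCivita Y Z) y) =
      fderiv ℝ (fderiv ℝ (chartField x₀ Z)) z a b
        + fderiv ℝ (chartField x₀ Z) z (fderiv ℝ (chartField x₀ Y) z a)
        + fderiv ℝ (christoffel (chartMetric x₀)) z a b c
        + christoffel (chartMetric x₀) z (fderiv ℝ (chartField x₀ Y) z a) c
        + christoffel (chartMetric x₀) z b (fderiv ℝ (chartField x₀ Z) z a)
        + christoffel (chartMetric x₀) z a (fderiv ℝ (chartField x₀ Z) z b)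
        + christoffel (chartMetric x₀) z a (christoffel (chartMetric x₀) z b c) := by
  have hG := isMetricOn_chartMetric (n := n) x₀
  intro z a b c
  have hzt := (extChartAt (𝓡 n) x₀).map_source hy
  have hYZ := smoothNear_leviCivita hzt hY hZ
  rw [chartCoord_leviCivita hy hX.differentiableAt hYZ.differentiableAt,
    chartCoord_leviCivita hy hY.differentiableAt hZ.differentiableAt]
  have hD : ContDiffAt ℝ ∞ (fderiv ℝ (chartField x₀ Z)) z := hZ.contDiffAt.fderiv_right (by simp)
  have hYd := hY.differentiableAt.hasLineDerivAt_fderiv a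
  have h1 := ((hD.differentiableAt (by simp)).hasLineDerivAt_fderiv a).clm_apply hYd |>.fun_add
    (((hG.hasLineDerivAt_christoffel hzt a).clm_apply hYd).clm_apply
      (hZ.differentiableAt.hasLineDerivAt_fderiv a))
  rw [(hYZ.differentiableAt.hasLineDerivAt_fderiv a).unique
    (h1.congr_of_eventuallyEq (chartField_leviCivita hzt hY hZ)), chartField_apply hy,
    chartField_apply hy]
  simp only [map_add, add_apply]
  abel

/-- The curvature in the chart at `x₀`. -/
lemma chartCoord_curvature {X Y Z : (y : M) → TangentSpace (𝓡 n) y}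
    (hy : y ∈ (extChartAt (𝓡 n) x₀).source)
    (hX : SmoothNear x₀ X (extChartAt (𝓡 n) x₀ y)) (hY : SmoothNear x₀ Y (extChartAt (𝓡 n) x₀ y))
    (hZ : SmoothNear x₀ Z (extChartAt (𝓡 n) x₀ y)) :
    chartCoord x₀ y (curvature X Y Z y) = curv (chartMetric x₀) (extChartAt (𝓡 n) x₀ y)
      (chartCoord x₀ y (X y)) (chartCoord x₀ y (Y y)) (chartCoord x₀ y (Z y)) := by
  have hzt := (extChartAt (𝓡 n) x₀).map_source hy
  -- The second derivatives of Z cancel by symmetry, and the bracket term absorbs the first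
  -- derivatives of X and Y.
  have hs := hZ.contDiffAt.isSymmSndFDerivAt
    (by simpa using (WithTop.coe_le_coe.2 le_top : ((2 : ℕ∞) : WithTop ℕ∞) ≤ ∞))
    (chartCoord x₀ y (X y)) (chartCoord x₀ y (Y y))
  rw [curvature, map_sub, map_sub, chartCoord_leviCivita_leviCivita hy hX hY hZ,
    chartCoord_leviCivita_leviCivita hy hY hX hZ,
    chartCoord_leviCivita hy (differentiableAt_chartField_mlieBracket hzt hX hY)
      hZ.differentiableAt, chartCoord_mlieBracket hy hX.differentiableAt hY.differentiableAt,
    curv_apply, hs]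
  simp only [map_sub, sub_apply]
  abel

/-- The components of an orthonormal frame at `y` in the chart at `x₀`. -/
def chartFrame (hy : y ∈ (extChartAt (𝓡 n) x₀).source) :
    Basis (Fin (finrank ℝ (TangentSpace (𝓡 n) y))) ℝ (EuclideanSpace ℝ (Fin n)) :=
  (tangentFrame n y).toBasis.map (chartEquiv hy)

lemma chartFrame_apply (hy : y ∈ (extChartAt (𝓡 n) x₀).source) (i) :
    chartFrame hy i = chartCoord x₀ y (tangentFrame n y i) := by
  simp [chartFrame, chartEquiv]

lemma isOrthonormalAt_chartFrame (hy : y ∈ (extChartAt (𝓡 n) x₀).source) :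
    IsOrthonormalAt (chartMetric x₀) (extChartAt (𝓡 n) x₀ y) (chartFrame hy) := fun i j ↦ by
  rw [chartFrame_apply, chartFrame_apply, chartMetric_chartCoord hy]
  exact orthonormal_iff_ite.1 (tangentFrame n y).orthonormal i j

/-- The Ricci tensor in the chart at `x₀`. -/
lemma ricci_eq_ric (hy : y ∈ (extChartAt (𝓡 n) x₀).source) (v w : TangentSpace (𝓡 n) y) :
    ricci n y v w = ric (chartMetric x₀) (extChartAt (𝓡 n) x₀ y) (chartCoord x₀ y v)
      (chartCoord x₀ y w) := by
  rw [(isOrthonormalAt_chartFrame hy).ric_eq, ricci]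
  refine Finset.sum_congr rfl fun i _ ↦ ?_
  rw [← chartMetric_chartCoord hy, chartCoord_curvature hy (smoothNear_extendVector _ hy)
    (smoothNear_extendVector _ hy) (smoothNear_extendVector _ hy), extendVector_self,
    extendVector_self, extendVector_self, chartFrame_apply]

end Chart
end

/-! ### Linear algebra of R² = s R, and propagation of zeros -/

/-- The eigenspaces of an endomorphism `R` with `R² = s R` and trace `2 s`. -/
lemma finrank_eigenspace_of_comp_self {W : Type*} [AddCommGroup W] [Module ℝ W]
    [FiniteDimensional ℝ W] {R : W →ₗ[ℝ] W} {s : ℝ} (hs : s ≠ 0) (hR : ∀ v, R (R v) = s • R v)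
    (htr : LinearMap.trace ℝ W R = 2 * s) :
    finrank ℝ (Module.End.eigenspace R s) = 2 ∧
      finrank ℝ (Module.End.eigenspace R 0) = finrank ℝ W - 2 := by
  have h1 : LinearMap.IsProj (Module.End.eigenspace R s) (s⁻¹ • R) := by
    refine ⟨fun v ↦ ?_, fun v hv ↦ ?_⟩
    · rw [Module.End.mem_eigenspace_iff]
      simp [hR, smul_smul, hs]
    · rw [Module.End.mem_eigenspace_iff] at hv
      simp [hv, smul_smul, hs]
  have h2 : LinearMap.IsProj (Module.End.eigenspace R 0) (LinearMap.id - s⁻¹ • R) := by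
    refine ⟨fun v ↦ ?_, fun v hv ↦ ?_⟩
    · rw [Module.End.mem_eigenspace_iff]
      simp [hR, smul_smul, hs]
    · rw [Module.End.mem_eigenspace_iff] at hv
      simp [hv]
  -- The trace of a projection is the dimension of its image.
  have t1 := h1.trace
  have t2 := h2.trace
  rw [map_smul, htr, smul_eq_mul, mul_left_comm, inv_mul_cancel₀ hs] at t1
  rw [map_sub, map_smul, htr, smul_eq_mul, mul_left_comm, inv_mul_cancel₀ hs,
    LinearMap.trace_id] at t2
  have t1' : finrank ℝ (Module.End.eigenspace R s) = 2 := by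
    exact_mod_cast (by linarith : (finrank ℝ (Module.End.eigenspace R s) : ℝ) = 2)
  refine ⟨t1', ?_⟩
  have t2' : finrank ℝ (Module.End.eigenspace R 0) + 2 = finrank ℝ W := by
    exact_mod_cast (by linarith : (finrank ℝ (Module.End.eigenspace R 0) : ℝ) + 2 = finrank ℝ W)
  omega

/-- A function with `dh = k h β` for a locally bounded one-form `β` which vanishes at a point near
`z₀` vanishes at all points near `z₀`. -/
lemma exists_nhds_eq_zero_iff {E : Type*} [NormedAddCommGroup E] [NormedSpace ℝ E] {V : Set E}
    (hV : IsOpen V) {z₀ : E} (hz₀ : z₀ ∈ V) {β : E → E →L[ℝ] ℝ} (hβ : ContinuousAt β z₀) {k : ℝ}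
    {h : E → ℝ} (hh : ∀ z ∈ V, ∀ u, HasLineDerivAt ℝ h (k * β z u * h z) z u) :
    ∃ U ∈ 𝓝 z₀, ∀ z ∈ U, ∀ z' ∈ U, h z = 0 → h z' = 0 := by
  have hb : ∀ᶠ z in 𝓝 z₀, ‖β z‖ < ‖β z₀‖ + 1 :=
    hβ.norm.eventually (gt_mem_nhds (lt_add_one _))
  obtain ⟨r, hr, hball⟩ := Metric.mem_nhds_iff.1 (Filter.inter_mem (hV.mem_nhds hz₀) hb)
  refine ⟨Metric.ball z₀ r, Metric.ball_mem_nhds z₀ hr, fun z hz z' hz' h0 ↦ ?_⟩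
  set u := z' - z
  have hmem : ∀ t ∈ Set.Icc (0 : ℝ) 1, z + t • u ∈ Metric.ball z₀ r := fun t ht ↦
    (convex_ball z₀ r).add_smul_sub_mem hz hz' ht
  have hd : ∀ t ∈ Set.Icc (0 : ℝ) 1, HasDerivAt (fun t ↦ h (z + t • u))
      (k * β (z + t • u) u * h (z + t • u)) t := by
    intro t ht
    have h1 := hh _ (hball (hmem t ht)).1 u
    -- The derivative at 0 along z + t • u + r • u is turned into a derivative at t by writing 0 as
    -- t − t and translating.
    rw [HasLineDerivAt, ← sub_self t] at h1
    have h2 := HasDerivAt.comp_sub_const t t h1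
    simpa [add_assoc, ← add_smul] using h2
  have key := eq_zero_of_abs_deriv_le_mul_abs_self_of_eq_zero_right
    (f := fun t ↦ h (z + t • u)) (f' := fun t ↦ k * β (z + t • u) u * h (z + t • u))
    -- K bounds |k β(u)| along the segment, since ‖β‖ < ‖β z₀‖ + 1 on the ball.
    (K := |k| * ((‖β z₀‖ + 1) * ‖u‖)) (a := 0) (b := 1)
    (fun t ht ↦ (hd t ht).continuousAt.continuousWithinAt)
    (fun t ht ↦ (hd t (Set.Ico_subset_Icc_self ht)).hasDerivWithinAt) (by simpa using h0)
    (fun t ht ↦ by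
      have hlt := (hball (hmem t (Set.Ico_subset_Icc_self ht))).2
      rw [norm_mul, norm_mul, Real.norm_eq_abs k]
      gcongr
      exact (ContinuousLinearMap.le_opNorm _ _).trans (by gcongr; exact hlt.le))
    1 (by simp)
  simpa [u] using key

namespace ChartMetric

variable {E : Type*} [NormedAddCommGroup E] [NormedSpace ℝ E] [FiniteDimensional ℝ E]

/-- The endomorphism `A² - (tr A / 2) A` for the Ricci endomorphism `A`. -/
noncomputable def ricDefect (G : E → E →L[ℝ] E →L[ℝ] ℝ) (z : E) : E →L[ℝ] E :=
  ricOp G z ∘L ricOp G z - (2⁻¹ * traceCLM E (ricOp G z)) • ricOp G z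

end ChartMetric

namespace IsRecurrentOn
open ChartMetric

variable {E : Type*} [NormedAddCommGroup E] [NormedSpace ℝ E] [FiniteDimensional ℝ E]
  {G : E → E →L[ℝ] E →L[ℝ] ℝ} {β : E → E →L[ℝ] ℝ} {V : Set E} {z : E}
variable (h : IsRecurrentOn G β V) (hz : z ∈ V)
include h hz

/-- Both A² and (tr A / 2) A have weight 2, the latter because tr A has weight 1 like A. -/
lemma isRecurrentEnd_ricDefect : IsRecurrentEnd G β (1 + 1) (ricDefect G) z := by
  have hA := h.isRecurrentEnd_ricOp hz
  refine (hA.comp hA).sub (IsRecurrentEnd.smul (l := 1) (fun u ↦ ?_) hA)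
  have h1 := HasLineDerivAt.fun_smul (hasLineDerivAt_const (2⁻¹ : ℝ)) (hA.trace u)
  refine HasDerivAt.congr_deriv h1 ?_
  simp
  ring

lemma ricDefect_symm (v w : E) : G z (ricDefect G z v) w = G z v (ricDefect G z w) := by
  have hs := h.toIsMetricOn.ricOp_symm hz
  simp [ricDefect, hs]

/-- For symmetric B, vanishing of B is equivalent to that of the scalar tr(B²), which has weight 2k
and falls under the Grönwall argument. -/
lemma exists_nhds_zero_iff_of_isRecurrentEnd {B : E → E →L[ℝ] E} {k : ℝ}
    (hB : ∀ z ∈ V, IsRecurrentEnd G β k B z)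
    (hs : ∀ z ∈ V, ∀ v w, G z (B z v) w = G z v (B z w)) :
    ∃ U ∈ 𝓝 z, ∀ z₁ ∈ U, ∀ z₂ ∈ U, B z₁ = 0 → B z₂ = 0 := by
  obtain ⟨U, hU, hUz⟩ := exists_nhds_eq_zero_iff (k := k + k) h.isOpen hz
    (h.differentiableAt z hz).continuousAt fun y hy u ↦ ((hB y hy).comp (hB y hy)).trace u
  refine ⟨U ∩ V, Filter.inter_mem hU (h.isOpen.mem_nhds hz), fun z₁ h₁ z₂ h₂ h0 ↦ ?_⟩
  refine h.toIsMetricOn.eq_zero_of_traceCLM_comp_self h₂.2 (hs z₂ h₂.2) (hUz z₁ h₁.1 z₂ h₂.1 ?_)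
  simp [h0]

end IsRecurrentOn

/-! ### Recurrence and the Ricci endomorphism in a chart -/

noncomputable section

section Chart

variable {n : ℕ} {M : Type*} [TopologicalSpace M] [ChartedSpace (EuclideanSpace ℝ (Fin n)) M]
  [IsManifold (𝓡 n) ∞ M] [RiemannianBundle (fun x : M ↦ TangentSpace (𝓡 n) x)]
  {x₀ y : M}

open ChartMetric

/-- A one-form in the chart at `x₀`. -/
def chartForm (x₀ : M) (β : (x : M) → TangentSpace (𝓡 n) x →L[ℝ] ℝ)
    (z : EuclideanSpace ℝ (Fin n)) : EuclideanSpace ℝ (Fin n) →L[ℝ] ℝ :=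
  β ((extChartAt (𝓡 n) x₀).symm z) ∘L chartVec x₀ ((extChartAt (𝓡 n) x₀).symm z)

lemma chartForm_chartCoord (β : (x : M) → TangentSpace (𝓡 n) x →L[ℝ] ℝ)
    (hy : y ∈ (extChartAt (𝓡 n) x₀).source) (v : TangentSpace (𝓡 n) y) :
    chartForm x₀ β (extChartAt (𝓡 n) x₀ y) (chartCoord x₀ y v) = β y v := by
  rw [chartForm, ContinuousLinearMap.comp_apply, (extChartAt (𝓡 n) x₀).left_inv hy,
    chartVec_chartCoord hy]

lemma contDiffOn_chartForm {β : (x : M) → TangentSpace (𝓡 n) x →L[ℝ] ℝ}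
    (hβ : ContMDiff (𝓡 n) ((𝓡 n).prod 𝓘(ℝ, EuclideanSpace ℝ (Fin n) →L[ℝ] ℝ)) ∞
      (fun x ↦ TotalSpace.mk' (EuclideanSpace ℝ (Fin n) →L[ℝ] ℝ)
        (E := fun x : M ↦ TangentSpace (𝓡 n) x →L[ℝ] ℝ) x (β x))) :
    ContDiffOn ℝ ∞ (chartForm x₀ β) (extChartAt (𝓡 n) x₀).target := by
  refine contDiffOn_clm_apply.2 fun a z hz ↦ ?_
  have hy := (extChartAt (𝓡 n) x₀).map_target hz
  have h1 := ContMDiffAt.clm_bundle_apply (F₁ := EuclideanSpace ℝ (Fin n)) (F₂ := ℝ)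
    (E₁ := fun x : M ↦ TangentSpace (𝓡 n) x) (E₂ := Bundle.Trivial M ℝ) (b := fun x ↦ x)
    (hβ.contMDiffAt) (contMDiffAt_chartVec a hy)
  have h2 : ContMDiffAt (𝓡 n) 𝓘(ℝ, ℝ) ∞ (fun w ↦ β w (chartVec x₀ w a))
      ((extChartAt (𝓡 n) x₀).symm z) := by
    simp only [contMDiffAt_totalSpace] at h1
    exact h1.2
  have h3 := (contMDiffAt_iff_chart hy).1 h2
  rw [(extChartAt (𝓡 n) x₀).right_inv hz] at h3
  exact h3.contDiffWithinAt

variable [IsContMDiffRiemannianBundle (𝓡 n) ∞ (EuclideanSpace ℝ (Fin n))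
    (fun x : M ↦ TangentSpace (𝓡 n) x)]

/-- The covariant derivative of the Ricci tensor in the chart at `x₀`. -/
lemma covDerivRicci_eq (hy : y ∈ (extChartAt (𝓡 n) x₀).source) (u v w : TangentSpace (𝓡 n) y) :
    covDerivRicci y u v w =
      fderiv ℝ (ric (chartMetric x₀)) (extChartAt (𝓡 n) x₀ y) (chartCoord x₀ y u)
        (chartCoord x₀ y v) (chartCoord x₀ y w)
      - ric (chartMetric x₀) (extChartAt (𝓡 n) x₀ y) (christoffel (chartMetric x₀)
          (extChartAt (𝓡 n) x₀ y) (chartCoord x₀ y u) (chartCoord x₀ y v)) (chartCoord x₀ y w)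
      - ric (chartMetric x₀) (extChartAt (𝓡 n) x₀ y) (chartCoord x₀ y v)
          (christoffel (chartMetric x₀)
            (extChartAt (𝓡 n) x₀ y) (chartCoord x₀ y u) (chartCoord x₀ y w)) := by
  have hG := isMetricOn_chartMetric (n := n) x₀
  have hz := (extChartAt (𝓡 n) x₀).map_source hy
  have hu := (smoothNear_extendVector u hy).differentiableAt
  have hv := (smoothNear_extendVector v hy).differentiableAt
  have hw := (smoothNear_extendVector w hy).differentiableAt
  have heq : Set.EqOn
      ((fun y ↦ ricci n y (extendVector v y) (extendVector w y)) ∘ (extChartAt (𝓡 n) x₀).symm)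
      (fun z ↦ ric (chartMetric x₀) z (chartField x₀ (extendVector v) z)
        (chartField x₀ (extendVector w) z)) (extChartAt (𝓡 n) x₀).target := fun z hz ↦ by
    simp only [Function.comp_apply]
    rw [ricci_eq_ric ((extChartAt (𝓡 n) x₀).map_target hz), (extChartAt (𝓡 n) x₀).right_inv hz]
    rfl
  have hd : DifferentiableAt ℝ (fun z ↦ ric (chartMetric x₀) z (chartField x₀ (extendVector v) z)
      (chartField x₀ (extendVector w) z)) (extChartAt (𝓡 n) x₀ y) :=
    ((hG.differentiableAt_of_contDiffOn hz hG.contDiffOn_ric).clm_apply hv).clm_apply hw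
  have hd' := hd.congr_of_eventuallyEq (heq.eventuallyEq_of_mem (hG.isOpen.mem_nhds hz))
  have h2 := ((hG.hasLineDerivAt_ric hz (chartCoord x₀ y u)).clm_apply
    (hv.hasLineDerivAt_fderiv _)).clm_apply (hw.hasLineDerivAt_fderiv _)
  rw [covDerivRicci, mvfderiv_eq_chart hy ((mdifferentiableAt_iff_chart hy).2 hd'),
    HasLineDerivAt.unique_of_eqOn hG.isOpen hz (hd'.hasLineDerivAt_fderiv _) h2 heq,
    ricci_eq_ric hy, ricci_eq_ric hy, chartCoord_leviCivita hy hu hv,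
    chartCoord_leviCivita hy hu hw, chartField_apply hy, chartField_apply hy, extendVector_self,
    extendVector_self, extendVector_self]
  -- The derivatives of the two extended fields cancel against those contained in ∇_u V and ∇_u W.
  simp only [map_add, add_apply]
  ring

lemma IsRicciRecurrent.isRecurrentOn {β : (x : M) → TangentSpace (𝓡 n) x →L[ℝ] ℝ}
    (hβ : IsRicciRecurrent β) (x₀ : M) :
    IsRecurrentOn (chartMetric x₀) (chartForm x₀ β) (extChartAt (𝓡 n) x₀).target where
  toIsMetricOn := isMetricOn_chartMetric x₀
  differentiableAt z hz := (isMetricOn_chartMetric (n := n) x₀).differentiableAt_of_contDiffOn hz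
    (contDiffOn_chartForm hβ.contMDiff)
  recurrent z hz u v w := by
    have hy := (extChartAt (𝓡 n) x₀).map_target hz
    have h := hβ.recurrent ((extChartAt (𝓡 n) x₀).symm z) (chartVec x₀ _ u) (chartVec x₀ _ v)
      (chartVec x₀ _ w)
    rw [covDerivRicci_eq hy, ricci_eq_ric hy, ← chartForm_chartCoord β hy] at h
    simpa only [chartCoord_chartVec hy, (extChartAt (𝓡 n) x₀).right_inv hz] using h

/-- The Ricci endomorphism in the chart at `x₀`. -/
lemma ricciOperator_eq (hy : y ∈ (extChartAt (𝓡 n) x₀).source) : ricciOperator n y =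
    (chartEquiv hy).symm.conj (ricOp (chartMetric x₀) (extChartAt (𝓡 n) x₀ y)).toLinearMap := by
  have hG := isMetricOn_chartMetric (n := n) x₀
  have hz := (extChartAt (𝓡 n) x₀).map_source hy
  refine (tangentFrame n y).toBasis.ext fun j ↦ ?_
  rw [← sum_inner_tangentFrame (LinearEquiv.conj _ _ _), ricciOperator, Basis.constr_basis]
  refine Finset.sum_congr rfl fun i _ ↦ ?_
  rw [ricci_eq_ric hy, ← hG.apply_ricOp hz, ← chartMetric_chartCoord hy]
  congr 3
  simp only [LinearEquiv.conj_apply_apply, LinearEquiv.symm_symm]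
  exact (chartCoord_chartVec hy _).symm

lemma chartCoord_ricciOperator (hy : y ∈ (extChartAt (𝓡 n) x₀).source) (v : TangentSpace (𝓡 n) y) :
    chartCoord x₀ y (ricciOperator n y v) =
      ricOp (chartMetric x₀) (extChartAt (𝓡 n) x₀ y) (chartCoord x₀ y v) := by
  rw [ricciOperator_eq hy]
  exact chartCoord_chartVec hy _

lemma trace_ricciOperator (hy : y ∈ (extChartAt (𝓡 n) x₀).source) :
    LinearMap.trace ℝ _ (ricciOperator n y) =
      traceCLM _ (ricOp (chartMetric x₀) (extChartAt (𝓡 n) x₀ y)) := by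
  rw [ricciOperator_eq hy, LinearMap.trace_conj']
  rfl

lemma scalarCurvature_eq (hy : y ∈ (extChartAt (𝓡 n) x₀).source) :
    scalarCurvature n y = traceCLM _ (ricOp (chartMetric x₀) (extChartAt (𝓡 n) x₀ y)) := by
  have hG := isMetricOn_chartMetric (n := n) x₀
  have hz := (extChartAt (𝓡 n) x₀).map_source hy
  rw [(isOrthonormalAt_chartFrame hy).traceCLM_eq, scalarCurvature]
  refine Finset.sum_congr rfl fun i _ ↦ ?_
  rw [ricci_eq_ric hy, hG.apply_ricOp hz, chartFrame_apply]

lemma ricciNormSq_eq (hy : y ∈ (extChartAt (𝓡 n) x₀).source) :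
    ricciNormSq n y = traceCLM _ (ricOp (chartMetric x₀) (extChartAt (𝓡 n) x₀ y) ∘L
      ricOp (chartMetric x₀) (extChartAt (𝓡 n) x₀ y)) := by
  have hG := isMetricOn_chartMetric (n := n) x₀
  have hz := (extChartAt (𝓡 n) x₀).map_source hy
  have he := isOrthonormalAt_chartFrame hy
  rw [he.traceCLM_eq, ricciNormSq]
  refine Finset.sum_congr rfl fun i _ ↦ ?_
  rw [ContinuousLinearMap.comp_apply, hG.ricOp_symm hz, ← he.sum_apply_mul]
  refine Finset.sum_congr rfl fun j _ ↦ ?_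
  rw [hG.symm _ hz (chartFrame hy j), hG.apply_ricOp hz, ricci_eq_ric hy, chartFrame_apply,
    chartFrame_apply, sq]

/-- A property which in every chart amounts to the vanishing of an endomorphism field depending
on the metric is constant if it is locally constant in charts. -/
lemma forall_of_chart_locallyConstant [ConnectedSpace M] {p : M → Prop}
    (B : M → EuclideanSpace ℝ (Fin n) → EuclideanSpace ℝ (Fin n) →L[ℝ] EuclideanSpace ℝ (Fin n))
    (hp : ∀ x₀ y, y ∈ (extChartAt (𝓡 n) x₀).source → (p y ↔ B x₀ (extChartAt (𝓡 n) x₀ y) = 0))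
    (hB : ∀ x₀, ∃ U ∈ 𝓝 (extChartAt (𝓡 n) x₀ x₀), ∀ z₁ ∈ U, ∀ z₂ ∈ U,
      B x₀ z₁ = 0 → B x₀ z₂ = 0) {x : M} (hx : p x) (y : M) : p y := by
  have hloc : IsLocallyConstant p := by
    refine (IsLocallyConstant.iff_eventually_eq p).2 fun x₀ ↦ ?_
    obtain ⟨U, hU, h⟩ := hB x₀
    have h0 := mem_extChartAt_source (I := 𝓡 n) x₀
    filter_upwards [continuousAt_extChartAt x₀ hU, extChartAt_source_mem_nhds (I := 𝓡 n) x₀]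
      with y hyU hy
    rw [hp x₀ y hy, hp x₀ x₀ h0]
    exact propext ⟨h _ hyU _ (mem_of_mem_nhds hU), h _ (mem_of_mem_nhds hU) _ hyU⟩
  rwa [hloc.apply_eq_of_preconnectedSpace y x]

end Chart
end

/-! ### Global conclusions on the manifold -/

noncomputable section

section Chart

variable {n : ℕ} {M : Type*} [TopologicalSpace M] [ChartedSpace (EuclideanSpace ℝ (Fin n)) M]
  [IsManifold (𝓡 n) ∞ M] [RiemannianBundle (fun x : M ↦ TangentSpace (𝓡 n) x)]
  [IsContMDiffRiemannianBundle (𝓡 n) ∞ (EuclideanSpace ℝ (Fin n))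
    (fun x : M ↦ TangentSpace (𝓡 n) x)]
  {β : (x : M) → TangentSpace (𝓡 n) x →L[ℝ] ℝ}

open ChartMetric

/-- A recurrent Ricci tensor vanishes nowhere. -/
lemma IsRicciRecurrent.ricOp_ne_zero [ConnectedSpace M] (hβ : IsRicciRecurrent β) {x₀ x : M}
    (hx : x ∈ (extChartAt (𝓡 n) x₀).source) :
    ricOp (chartMetric x₀) (extChartAt (𝓡 n) x₀ x) ≠ 0 := by
  intro h0
  have hp (x₀ y : M) (hy : y ∈ (extChartAt (𝓡 n) x₀).source) :
      ricciOperator n y = 0 ↔ ricOp (chartMetric x₀) (extChartAt (𝓡 n) x₀ y) = 0 := by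
    rw [ricciOperator_eq hy, LinearEquiv.map_eq_zero_iff]
    exact ⟨fun h ↦ ContinuousLinearMap.coe_injective h, fun h ↦ by rw [h]; rfl⟩
  obtain ⟨y, v, w, hvw⟩ := hβ.ricci_ne_zero
  have hy := mem_extChartAt_source (I := 𝓡 n) y
  have key := forall_of_chart_locallyConstant (fun x₀ ↦ ricOp (chartMetric x₀)) hp (fun x₀ ↦
    have h := hβ.isRecurrentOn x₀
    h.exists_nhds_zero_iff_of_isRecurrentEnd (mem_extChartAt_target x₀)
      (fun z hz ↦ h.isRecurrentEnd_ricOp hz) (fun z hz ↦ h.toIsMetricOn.ricOp_symm hz))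
    ((hp x₀ x hx).2 h0) y
  rw [hp y y hy] at key
  rw [ricci_eq_ric hy, ← (isMetricOn_chartMetric y).apply_ricOp (mem_extChartAt_target y),
    key] at hvw
  simp at hvw

/-- The Ricci endomorphism `A` of a metric with recurrent Ricci tensor satisfies
`A ∘ A = (tr A / 2) • A`. -/
lemma IsRicciRecurrent.ricciOperator_ricciOperator [ConnectedSpace M] (hβ : IsRicciRecurrent β)
    (x : M) (v : TangentSpace (𝓡 n) x) : ricciOperator n x (ricciOperator n x v) =
      (scalarCurvature n x / 2) • ricciOperator n x v := by
  have hp (x₀ y : M) (hy : y ∈ (extChartAt (𝓡 n) x₀).source) :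
      (∀ v, ricciOperator n y (ricciOperator n y v) =
        (scalarCurvature n y / 2) • ricciOperator n y v) ↔
      ricDefect (chartMetric x₀) (extChartAt (𝓡 n) x₀ y) = 0 := by
    have hinj : Function.Injective (chartCoord x₀ y) := (chartEquiv hy).injective
    have hsurj : Function.Surjective (chartCoord x₀ y) := (chartEquiv hy).surjective
    rw [ContinuousLinearMap.ext_iff, hsurj.forall]
    refine forall_congr' fun v ↦ ?_
    rw [← hinj.eq_iff, chartCoord_ricciOperator hy, map_smul, chartCoord_ricciOperator hy,
      scalarCurvature_eq hy, ricDefect, sub_apply, zero_apply, sub_eq_zero, smul_apply,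
      ContinuousLinearMap.comp_apply, div_eq_inv_mul]
  -- The propagation starts at a point where β ≠ 0, the only place where A² = (tr A / 2) A is known
  -- so far.
  obtain ⟨p, hpβ⟩ := hβ.form_ne_zero
  have hpp := mem_extChartAt_source (I := 𝓡 n) p
  have hform : chartForm p β (extChartAt (𝓡 n) p p) ≠ 0 := by
    intro h0
    refine hpβ (ContinuousLinearMap.ext fun v ↦ ?_)
    rw [← chartForm_chartCoord β hpp, h0]
    rfl
  refine forall_of_chart_locallyConstant (fun x₀ ↦ ricDefect (chartMetric x₀)) hp (fun x₀ ↦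
    have h := hβ.isRecurrentOn x₀
    h.exists_nhds_zero_iff_of_isRecurrentEnd (mem_extChartAt_target x₀)
      (fun z hz ↦ h.isRecurrentEnd_ricDefect hz) (fun z hz ↦ h.ricDefect_symm hz))
    ((hp p p hpp).2 ?_) x v
  rw [ricDefect, (hβ.isRecurrentOn p).ricOp_comp_self (mem_extChartAt_target p) hform,
    div_eq_inv_mul, sub_self]

lemma IsRicciRecurrent.ricOp_comp_self_eq [ConnectedSpace M] (hβ : IsRicciRecurrent β) {x₀ x : M}
    (hx : x ∈ (extChartAt (𝓡 n) x₀).source) :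
    ricOp (chartMetric x₀) (extChartAt (𝓡 n) x₀ x) ∘L
      ricOp (chartMetric x₀) (extChartAt (𝓡 n) x₀ x) =
      (scalarCurvature n x / 2) • ricOp (chartMetric x₀) (extChartAt (𝓡 n) x₀ x) := by
  ext1 a
  obtain ⟨v, rfl⟩ : ∃ v, chartCoord x₀ x v = a := ⟨_, chartCoord_chartVec hx a⟩
  have h := congrArg (chartCoord x₀ x) (hβ.ricciOperator_ricciOperator x v)
  rwa [map_smul, chartCoord_ricciOperator hx, chartCoord_ricciOperator hx] at h

lemma IsRicciRecurrent.scalarCurvature_sq [ConnectedSpace M] (hβ : IsRicciRecurrent β) (x : M) :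
    scalarCurvature n x ^ 2 = 2 * ricciNormSq n x := by
  have hx := mem_extChartAt_source (I := 𝓡 n) x
  rw [ricciNormSq_eq hx, hβ.ricOp_comp_self_eq hx, map_smul, ← scalarCurvature_eq hx, smul_eq_mul]
  ring

/-- If sc vanished at x, then A² = 0 there, and symmetry would force A = 0. -/
lemma IsRicciRecurrent.scalarCurvature_ne_zero [ConnectedSpace M] (hβ : IsRicciRecurrent β)
    (x : M) : scalarCurvature n x ≠ 0 := by
  intro h0
  have hx := mem_extChartAt_source (I := 𝓡 n) x
  have hG := isMetricOn_chartMetric (n := n) x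
  have hz := mem_extChartAt_target (I := 𝓡 n) x
  refine hβ.ricOp_ne_zero hx (hG.eq_zero_of_traceCLM_comp_self hz (hG.ricOp_symm hz) ?_)
  rw [hβ.ricOp_comp_self_eq hx, h0]
  simp

lemma inner_sharp {x : M} (α : TangentSpace (𝓡 n) x →L[ℝ] ℝ) (v : TangentSpace (𝓡 n) x) :
    inner ℝ (sharp α) v = α v := by
  conv_rhs => rw [← sum_inner_tangentFrame v]
  simp only [sharp, sum_inner, real_inner_smul_left, map_sum, map_smul, smul_eq_mul]
  exact Finset.sum_congr rfl fun i _ ↦ by rw [real_inner_comm, mul_comm]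

lemma IsRicciRecurrent.ricciOperator_sharp (hβ : IsRicciRecurrent β) (x : M) :
    ricciOperator n x (sharp (β x)) = (scalarCurvature n x / 2) • sharp (β x) := by
  have hx := mem_extChartAt_source (I := 𝓡 n) x
  have h := (hβ.isRecurrentOn x).ricOp_sharp (mem_extChartAt_target x)
    (b := chartCoord x x (sharp (β x))) fun c ↦ by
      obtain ⟨v, rfl⟩ : ∃ v, chartCoord x x v = c := ⟨_, chartCoord_chartVec hx c⟩
      rw [chartMetric_chartCoord hx, inner_sharp, chartForm_chartCoord β hx]
  rw [← chartCoord_ricciOperator hx, ← scalarCurvature_eq hx, ← map_smul] at h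
  exact (chartEquiv hx).injective h

lemma IsRicciRecurrent.mvfderiv_log_scalarCurvature (hβ : IsRicciRecurrent β) {x : M}
    (h0 : scalarCurvature n x ≠ 0) :
    MDifferentiableAt (𝓡 n) 𝓘(ℝ, ℝ) (fun y : M ↦ Real.log |scalarCurvature n y|) x ∧
      mvfderiv (𝓡 n) (fun y : M ↦ Real.log |scalarCurvature n y|) x = β x := by
  have hx := mem_extChartAt_source (I := 𝓡 n) x
  have hz := mem_extChartAt_target (I := 𝓡 n) x
  have h := hβ.isRecurrentOn x
  have hG := h.toIsMetricOn
  have heq : Set.EqOn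
      ((fun y : M ↦ Real.log |scalarCurvature n y|) ∘ (extChartAt (𝓡 n) x).symm)
      (fun z ↦ Real.log (traceCLM _ (ricOp (chartMetric x) z))) (extChartAt (𝓡 n) x).target :=
    fun z hz ↦ by
      -- `Real.log` satisfies log |t| = log t for every real t, so no case distinction on the sign
      -- of sc is needed.
      simp only [Function.comp_apply, Real.log_abs]
      rw [scalarCurvature_eq ((extChartAt (𝓡 n) x).map_target hz),
        (extChartAt (𝓡 n) x).right_inv hz]
  rw [scalarCurvature_eq hx] at h0
  have ht : DifferentiableAt ℝ (fun z ↦ traceCLM _ (ricOp (chartMetric x) z))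
      (extChartAt (𝓡 n) x x) :=
    (traceCLM (EuclideanSpace ℝ (Fin n))).differentiableAt.comp _
      (hG.differentiableAt_of_contDiffOn hz hG.contDiffOn_ricOp)
  have hd' := (ht.log h0).congr_of_eventuallyEq (heq.eventuallyEq_of_mem (hG.isOpen.mem_nhds hz))
  have hm := (mdifferentiableAt_iff_chart hx).2 hd'
  refine ⟨hm, ContinuousLinearMap.ext fun v ↦ ?_⟩
  have h1 : HasLineDerivAt ℝ (fun z ↦ Real.log (traceCLM _ (ricOp (chartMetric x) z))) _ _
      (chartCoord x x v) :=
    HasDerivAt.log ((h.isRecurrentEnd_ricOp hz).trace (chartCoord x x v)) (by simpa using h0)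
  rw [mvfderiv_eq_chart hx hm, HasLineDerivAt.unique_of_eqOn hG.isOpen hz
    (hd'.hasLineDerivAt_fderiv _) h1 heq, chartForm_chartCoord β hx, zero_smul, add_zero, one_mul,
    mul_div_assoc, div_self h0, mul_one]

end Chart
end

end RecurrentRicci

theorem mainTheorem1 {n : ℕ} (hn : 3 ≤ n) {M : Type*} [TopologicalSpace M] [T2Space M]
    [SecondCountableTopology M] [ConnectedSpace M] [ChartedSpace (EuclideanSpace ℝ (Fin n)) M]
    [IsManifold (𝓡 n) ∞ M] [RiemannianBundle (fun x : M ↦ TangentSpace (𝓡 n) x)]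
    [IsContMDiffRiemannianBundle (𝓡 n) ∞ (EuclideanSpace ℝ (Fin n))
      (fun x : M ↦ TangentSpace (𝓡 n) x)]
    (β : (x : M) → TangentSpace (𝓡 n) x →L[ℝ] ℝ) (hβ : IsRicciRecurrent β) (x : M) :
    scalarCurvature n x ≠ 0 ∧
    finrank ℝ (Module.End.eigenspace (ricciOperator n x) (scalarCurvature n x / 2)) = 2 ∧
    finrank ℝ (Module.End.eigenspace (ricciOperator n x) 0) = n - 2 ∧
    (MDifferentiableAt (𝓡 n) 𝓘(ℝ, ℝ) (fun y : M ↦ Real.log |scalarCurvature n y|) x ∧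
      mvfderiv (𝓡 n) (fun y : M ↦ Real.log |scalarCurvature n y|) x = β x) ∧
    scalarCurvature n x ^ 2 = 2 * ricciNormSq n x ∧
    ricciOperator n x (sharp (β x)) = (scalarCurvature n x / 2) • sharp (β x) := by
  have hx := mem_extChartAt_source (I := 𝓡 n) x
  have h0 := hβ.scalarCurvature_ne_zero x
  have h1 := finrank_eigenspace_of_comp_self (div_ne_zero h0 two_ne_zero)
    (hβ.ricciOperator_ricciOperator x)
    (by rw [trace_ricciOperator hx, ← scalarCurvature_eq hx]; ring)
  have hfr : finrank ℝ (TangentSpace (𝓡 n) x) = n := finrank_euclideanSpace_fin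
  rw [hfr] at h1
  exact ⟨h0, h1.1, h1.2, hβ.mvfderiv_log_scalarCurvature h0, hβ.scalarCurvature_sq x,
    hβ.ricciOperator_sharp x⟩
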